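/- Write $r=\sqrt{x_1^2+x_2^2}$. A $2\tfrac12$D field is $u=u^H+u^3e_z$ with $u^H=(u^1,u^2,0)$, where $u^1,u^2,u^3$ and the pressure $p$ depend only on $(x_1,x_2)$. It is called reflection symmetric if $u^1$ is even in $x_2$ while $u^2$ and $u^3$ are odd in $x_2$. A $(-\alpha)$-homogeneous solution is a pair $(u,p)$ with $u(x)=\lambda^{\alpha}u(\lambda x)$ and $p(x)=\lambda^{2\alpha}p(\lambda x)$ for all $\lambda>0$ that solves the stationary Euler equations $u\cdot\nabla u+\nabla p=0$, $\nabla\cdot u=0$. (i) For every $\alpha>1$ there is a reflection-symmetric $2\tfrac12$D $(-\alpha)$-homogeneous solution $(u,p)$ in $\mathbb{R}^3\setminus\{r=0\}$ (in the classical sense) such that $r^{2\alpha}p$ is constant, $u\in C^1(\mathbb{R}^2\setminus\{0\})$, $u^H\in C^2(\mathbb{R}^2\setminus\{0\})$ and $u^3\in C^1(\mathbb{R}^2\setminus\{0\})$. (ii) For every $\alpha<-1$ there is a reflection-symmetric $2\tfrac12$D $(-\alpha)$-homogeneous solution $(u,p)$ in $\mathbb{R}^3$ (continuous, in the sense of distributions)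 such that $r^{2\alpha}p$ is constant on $\{r\neq0\}$, $u\in C(\mathbb{R}^2)$, $u^H\in C^1(\mathbb{R}^2\setminus\{0\})\cap C(\mathbb{R}^2)$ and $u^3\in C(\mathbb{R}^2)$. In both cases the solution can be taken rotational and genuinely $2\tfrac12$-dimensional, in the sense that $\partial_1u^2-\partial_2u^1\not\equiv0$ and $u^3\not\equiv0$ on $\mathbb{R}^2\setminus\{0\}$. -/

import Mathlib

open scoped ContDiff

/-- The `j`-th partial derivative at `x` of a scalar function on `ℝⁿ`. -/
noncomputable def partialD {n : ℕ} (j : Fin n) (f : EuclideanSpace ℝ (Fin n) → ℝ)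
    (x : EuclideanSpace ℝ (Fin n)) : ℝ :=
  fderiv ℝ f x (EuclideanSpace.single j 1)

/-- `(u, p)` is a classical `C¹` solution on `Ω ⊆ ℝ³` of the stationary incompressible Euler
equations `u · ∇u + ∇p = 0`, `∇ · u = 0`. -/
def IsClassicalEuler (Ω : Set (EuclideanSpace ℝ (Fin 3)))
    (u : EuclideanSpace ℝ (Fin 3) → EuclideanSpace ℝ (Fin 3))
    (p : EuclideanSpace ℝ (Fin 3) → ℝ) : Prop :=
  ContDiffOn ℝ 1 u Ω ∧ ContDiffOn ℝ 1 p Ω ∧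
  (∀ x ∈ Ω, ∀ i : Fin 3,
    (∑ j : Fin 3, u x j * partialD j (fun y => u y i) x) + partialD i p x = 0) ∧
  (∀ x ∈ Ω, ∑ j : Fin 3, partialD j (fun y => u y j) x = 0)

/-- `(u, p)` is a continuous distributional solution on all of `ℝ³` of the stationary
incompressible Euler equations `∇ · (u ⊗ u) + ∇p = 0`, `∇ · u = 0`. -/
def IsDistributionalEuler
    (u : EuclideanSpace ℝ (Fin 3) → EuclideanSpace ℝ (Fin 3))
    (p : EuclideanSpace ℝ (Fin 3) → ℝ) : Prop :=
  Continuous u ∧ Continuous p ∧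
  (∀ φ : EuclideanSpace ℝ (Fin 3) → ℝ, ContDiff ℝ ∞ φ → HasCompactSupport φ →
    (∀ i : Fin 3,
      ∫ x, ((∑ j : Fin 3, u x i * u x j * partialD j φ x) + p x * partialD i φ x) = 0) ∧
    ∫ x, (∑ j : Fin 3, u x j * partialD j φ x) = 0)

/-- The projection `(x₁, x₂, x₃) ↦ (x₁, x₂)`. -/
noncomputable def horiz (x : EuclideanSpace ℝ (Fin 3)) : EuclideanSpace ℝ (Fin 2) :=
  !₂[x 0, x 1]

/-- A function of `(x₁, x₂)` regarded as a function on `ℝ³` that is independent of `x₃`. -/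
noncomputable def extend3 {F : Type*} (f : EuclideanSpace ℝ (Fin 2) → F) :
    EuclideanSpace ℝ (Fin 3) → F :=
  fun x => f (horiz x)

/-- The horizontal part `u^H = (u¹, u²)` of a field `u = (u¹, u², u³)` depending on `(x₁, x₂)`. -/
noncomputable def horizPart (u : EuclideanSpace ℝ (Fin 2) → EuclideanSpace ℝ (Fin 3)) :
    EuclideanSpace ℝ (Fin 2) → EuclideanSpace ℝ (Fin 2) :=
  fun x => horiz (u x)

/-- `f(x) = λ^a f(λ x)` for all `λ > 0` and `x ∈ S`: homogeneity of degree `-a`, on a set `S`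
that is invariant under dilations. -/
def IsNegHomogeneousOn {F : Type*} [AddCommGroup F] [Module ℝ F] (a : ℝ)
    (f : EuclideanSpace ℝ (Fin 2) → F) (S : Set (EuclideanSpace ℝ (Fin 2))) : Prop :=
  ∀ l : ℝ, 0 < l → ∀ x ∈ S, f x = l ^ a • f (l • x)

/-- Reflection symmetry in `x₂`: `u¹` is even, `u²` and `u³` are odd. -/
def IsReflectionSymmetricOn (u : EuclideanSpace ℝ (Fin 2) → EuclideanSpace ℝ (Fin 3))
    (S : Set (EuclideanSpace ℝ (Fin 2))) : Prop :=
  ∀ x ∈ S, u x 0 = u !₂[x 0, -x 1] 0 ∧ u x 1 = -u !₂[x 0, -x 1] 1 ∧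
    u x 2 = -u !₂[x 0, -x 1] 2

/-- The vorticity `∂₁u² - ∂₂u¹` of the horizontal part, i.e. the `e_z`-component of `∇ × u`. -/
noncomputable def horizVorticity (u : EuclideanSpace ℝ (Fin 2) → EuclideanSpace ℝ (Fin 3))
    (x : EuclideanSpace ℝ (Fin 2)) : ℝ :=
  partialD 0 (fun y => u y 1) x - partialD 1 (fun y => u y 0) x

/-! Take a homogeneous stream function `ψ = r ^ (1 - α) f(θ)` and set `u^H = (∂₂ψ, -∂₁ψ)`, which is
automatically divergence free. Put `b = α / (α - 1)`. A planar flow is steady when its vorticity and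
its Bernoulli function depend on `ψ` compatibly; homogeneity then forces a vorticity proportional to
`ψ |ψ| ^ (2b - 2)` and a Bernoulli function proportional to `|ψ| ^ (2b)`. With `r ^ (2α) p` constant
this becomes the oscillator `f'' = -(α - 1)² f - K b f |f| ^ (2b - 2)`, whose energy integral fixes
the pressure constant. The vertical component is the signed power `ψ ^ b`: it has degree `-α`, is
constant along streamlines, and inherits the oddness of `f`.

What remains is an odd `2π`-periodic `f`. Normalise the amplitude to 1 and write `f = sin φ`; the
energy integral becomes `φ' = V(φ)` with `V` positive and `π`-periodic. The time in which `φ`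
advances by `π` is `π / |α - 1|` at `K = 0` and becomes arbitrarily small for large `K`, so for any
integer `m > |α - 1|` some `K > 0` makes it `π / m` (`exists_halfPeriod_eq`,
`exists_periodic_profile`). Positivity of `K` makes the flow rotational.

For `α > 1` one has `b > 1`, all powers involved are `C¹`, and the equations hold classically off
the axis. For `α < -1` one has `1/2 < b < 1`: `u^H` and `p` are `C¹` even at the origin, but `u³` is
only known to be continuous. Its transport equation is read weakly, since `u³ u^H` is the rotated
gradient of the `C¹` function `|ψ| ^ (b + 1) / (b + 1)` (`weak_divergence_perp_grad`,
`partialD_momentumStream`). -/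

open Filter Topology MeasureTheory

/-! ### Signed powers and derivatives at exceptional points. -/

/-- The signed power `s ↦ sgn(s) |s| ^ a`. -/
noncomputable def signedPow (a s : ℝ) : ℝ := s * |s| ^ (a - 1)

theorem signedPow_neg (a s : ℝ) : signedPow a (-s) = -signedPow a s := by
  simp [signedPow]

theorem mul_signedPow {a : ℝ} (ha : a + 1 ≠ 0) (s : ℝ) : s * signedPow a s = |s| ^ (a + 1) := by
  rcases eq_or_ne s 0 with rfl | hs
  · simp [signedPow, Real.zero_rpow ha]
  · have h : |s| ^ (a + 1) = |s| ^ (a - 1) * |s| ^ (2 : ℝ) := by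
      rw [← Real.rpow_add (abs_pos.2 hs)]; congr 1; ring
    rw [h, signedPow, Real.rpow_two, sq_abs]; ring

/-- For `a < 1` the factor `|s| ^ (a - 1)` is singular at 0; splitting into positive and negative
parts shows continuity for every `a > 0`. -/
theorem signedPow_eq_max {a : ℝ} (ha : a ≠ 0) (s : ℝ) :
    signedPow a s = max s 0 ^ a - max (-s) 0 ^ a := by
  rcases lt_trichotomy s 0 with h | rfl | h
  · rw [max_eq_right h.le, max_eq_left (by linarith), Real.zero_rpow ha, signedPow,
      abs_of_neg h, Real.rpow_sub_one (by linarith), div_neg, mul_neg, mul_div_cancel₀ _ h.ne]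
    simp
  · simp [signedPow]
  · rw [max_eq_left h.le, max_eq_right (by linarith), Real.zero_rpow ha, signedPow,
      abs_of_pos h, Real.rpow_sub_one (by linarith)]
    field_simp
    simp

theorem continuous_signedPow {a : ℝ} (ha : 0 < a) : Continuous (signedPow a) := by
  rw [show signedPow a = fun s => max s 0 ^ a - max (-s) 0 ^ a from
    funext (signedPow_eq_max ha.ne')]
  exact ((continuous_id.max continuous_const).rpow_const fun _ => Or.inr ha.le).sub
    ((continuous_neg.max continuous_const).rpow_const fun _ => Or.inr ha.le)

theorem continuous_abs_rpow {a : ℝ} (ha : 0 ≤ a) : Continuous fun s : ℝ => |s| ^ a :=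
  continuous_abs.rpow_const fun _ => Or.inr ha

theorem hasDerivAt_signedPow {a : ℝ} (ha : 1 < a) (s : ℝ) :
    HasDerivAt (signedPow a) (a * |s| ^ (a - 1)) s := by
  have key : ∀ y : ℝ, y ≠ 0 → HasDerivAt (signedPow a) (a * |y| ^ (a - 1)) y := by
    intro y hy
    have h1 : HasDerivAt (fun s : ℝ => |s| ^ (a - 1))
        ((SignType.sign y : ℝ) * (a - 1) * |y| ^ (a - 1 - 1)) y :=
      (hasDerivAt_abs hy).rpow_const (Or.inl (abs_ne_zero.2 hy))
    have h2 := (hasDerivAt_id y).mul h1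
    refine h2.congr_deriv ?_
    rw [Real.rpow_sub_one (abs_ne_zero.2 hy) (a - 1)]
    have h3 : y * (SignType.sign y : ℝ) = |y| := self_mul_sign y
    have h4 : |y| ≠ 0 := abs_ne_zero.2 hy
    simp only [id]
    field_simp
    linear_combination (a - 1) * h3
  rcases eq_or_ne s 0 with rfl | hs
  · exact hasDerivAt_of_hasDerivAt_of_ne key (continuous_signedPow (by linarith)).continuousAt
      ((continuous_abs_rpow (by linarith)).const_mul a).continuousAt
  · exact key s hs

theorem hasDerivAt_abs_rpow_signedPow {a : ℝ} (ha : 1 < a) (s : ℝ) :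
    HasDerivAt (fun s : ℝ => |s| ^ a) (a * signedPow (a - 1) s) s := by
  refine (hasDerivAt_abs_rpow s ha).congr_deriv ?_
  rw [signedPow, show a - 1 - 1 = a - 2 by ring]; ring

theorem contDiff_signedPow {a : ℝ} (ha : 1 < a) : ContDiff ℝ 1 (signedPow a) := by
  rw [contDiff_one_iff_deriv]
  refine ⟨fun s => (hasDerivAt_signedPow ha s).differentiableAt, ?_⟩
  rw [funext fun s => (hasDerivAt_signedPow ha s).deriv]
  exact (continuous_abs_rpow (by linarith)).const_mul a

/-- Where `g` does not vanish, continuity fixes its sign, so `g` is locally one branch of the square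
root of `G`. -/
theorem hasDerivAt_of_sq_eq {g G : ℝ → ℝ} {G' x : ℝ} (hg : ContinuousAt g x)
    (hG : HasDerivAt G G' x) (h : ∀ y, g y ^ 2 = G y) (hx : g x ≠ 0) :
    HasDerivAt g (G' / (2 * g x)) x := by
  have hGx : G x ≠ 0 := by rw [← h]; exact pow_ne_zero 2 hx
  have hs := hG.sqrt hGx
  rcases lt_or_gt_of_ne hx with hx' | hx'
  · have he : g =ᶠ[𝓝 x] fun y => -√(G y) := by
      filter_upwards [hg.eventually_lt_const hx'] with y hy
      rw [← h, Real.sqrt_sq_eq_abs, abs_of_neg hy, neg_neg]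
    refine (hs.neg.congr_of_eventuallyEq he).congr_deriv ?_
    rw [he.self_of_nhds, mul_neg, div_neg]
  · have he : g =ᶠ[𝓝 x] fun y => √(G y) := by
      filter_upwards [hg.eventually_const_lt hx'] with y hy
      rw [← h, Real.sqrt_sq_eq_abs, abs_of_pos hy]
    refine (hs.congr_of_eventuallyEq he).congr_deriv ?_
    rw [he.self_of_nhds]

/-- The fundamental theorem of calculus tolerates countably many exceptional points, so `g` is a
primitive of the continuous `g'`, hence differentiable at those points too. -/
theorem hasDerivAt_of_hasDerivAt_off_countable {g g' : ℝ → ℝ} {s : Set ℝ} (hs : s.Countable)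
    (hg : Continuous g) (hg' : Continuous g') (h : ∀ x, x ∉ s → HasDerivAt g (g' x) x) (x : ℝ) :
    HasDerivAt g (g' x) x := by
  have key : g = fun y => g 0 + ∫ t in (0 : ℝ)..y, g' t := by
    funext y
    rw [MeasureTheory.integral_eq_of_hasDerivAt_off_countable g g' hs hg.continuousOn
      (fun z hz => h z hz.2) (hg'.intervalIntegrable _ _)]
    ring
  rw [key]
  exact (intervalIntegral.integral_hasDerivAt_right (hg'.intervalIntegrable _ _)
    hg'.aestronglyMeasurable.stronglyMeasurableAtFilter hg'.continuousAt).const_add _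

/-! ### Periodic solutions of the profile equation. -/

/-- The quotient `(1 - |sin x| ^ (2b)) / (1 - sin² x)`, continuously extended. -/
noncomputable def sinQuotient (b x : ℝ) : ℝ := dslope (fun t : ℝ => t ^ b) 1 (Real.sin x ^ 2)

theorem continuous_sinQuotient {b : ℝ} (hb : 0 < b) : Continuous (sinQuotient b) := by
  have h : Continuous (dslope (fun t : ℝ => t ^ b) 1) := by
    rw [← continuousOn_univ, continuousOn_dslope univ_mem]
    exact ⟨(continuous_id.rpow_const fun _ => Or.inr hb.le).continuousOn,
      (Real.hasDerivAt_rpow_const (Or.inl one_ne_zero)).differentiableAt⟩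
  exact h.comp (Real.continuous_sin.pow 2)

theorem cos_sq_mul_sinQuotient (b x : ℝ) :
    Real.cos x ^ 2 * sinQuotient b x = 1 - |Real.sin x| ^ (2 * b) := by
  have h := sub_smul_dslope (fun t : ℝ => t ^ b) 1 (Real.sin x ^ 2)
  rw [smul_eq_mul, Real.one_rpow] at h
  have h2 : (Real.sin x ^ 2) ^ b = |Real.sin x| ^ (2 * b) := by
    rw [← sq_abs, ← Real.rpow_two, ← Real.rpow_mul (abs_nonneg _)]
  rw [← h2, sinQuotient, Real.cos_sq']
  linarith

theorem sinQuotient_pos {b : ℝ} (hb : 0 < b) (x : ℝ) : 0 < sinQuotient b x := by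
  rcases eq_or_ne (Real.cos x) 0 with h | h
  · have h1 : Real.sin x ^ 2 = 1 := by rw [Real.sin_sq, h]; simp
    rw [sinQuotient, h1, dslope_same, (Real.hasDerivAt_rpow_const (Or.inl one_ne_zero)).deriv]
    simpa using hb
  · have h1 := cos_sq_mul_sinQuotient b x
    have h2 : 0 < Real.cos x ^ 2 := by positivity
    have h3 : |Real.sin x| < 1 := by
      rw [← sq_lt_one_iff_abs_lt_one, Real.sin_sq]; linarith
    have h4 := Real.rpow_lt_one (abs_nonneg _) h3 (by linarith : 0 < 2 * b)
    exact pos_of_mul_pos_right (by linarith : 0 < Real.cos x ^ 2 * sinQuotient b x) h2.le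

theorem sinQuotient_neg (b x : ℝ) : sinQuotient b (-x) = sinQuotient b x := by
  simp [sinQuotient]

theorem sinQuotient_periodic (b : ℝ) : Function.Periodic (sinQuotient b) Real.pi := by
  intro x; simp [sinQuotient]

/-- A positive even continuous `π`-periodic function is the right-hand side of an autonomous
equation whose solution through the origin is odd and advances by `π` over the half period. -/
theorem exists_odd_rotation {V : ℝ → ℝ} (hV : Continuous V) (hpos : ∀ x, 0 < V x)
    (heven : ∀ x, V (-x) = V x) (hper : Function.Periodic V Real.pi) :
    ∃ φ : ℝ → ℝ, Function.Bijective φ ∧ (∀ x, HasDerivAt φ (V (φ x)) x) ∧ (∀ x, φ (-x) = -φ x) ∧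
      ∀ x, φ (x + ∫ t in (0 : ℝ)..Real.pi, (V t)⁻¹) = φ x + Real.pi := by
  set T := ∫ t in (0 : ℝ)..Real.pi, (V t)⁻¹
  have hc : Continuous fun t => (V t)⁻¹ := hV.inv₀ fun x => (hpos x).ne'
  have hp : ∀ x, 0 < (V x)⁻¹ := fun x => inv_pos.2 (hpos x)
  have hper' : Function.Periodic (fun t => (V t)⁻¹) Real.pi := fun x => by simp only [hper x]
  have hi : ∀ a b, IntervalIntegrable (fun t => (V t)⁻¹) MeasureTheory.volume a b :=
    fun a b => hc.intervalIntegrable a b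
  -- Separation of variables: `Θ` is the time at which the phase reaches a given value, and the
  -- solution is its inverse. Oddness and the advance by `π` are read off from `Θ`.
  set Θ : ℝ → ℝ := fun x => ∫ t in (0 : ℝ)..x, (V t)⁻¹ with hΘ
  have hd : ∀ x, HasDerivAt Θ (V x)⁻¹ x := fun x =>
    intervalIntegral.integral_hasDerivAt_right (hi _ _)
      hc.aestronglyMeasurable.stronglyMeasurableAtFilter hc.continuousAt
  have hmono : StrictMono Θ := strictMono_of_hasDerivAt_pos hd hp
  have hcont : Continuous Θ := continuous_iff_continuousAt.2 fun x => (hd x).continuousAt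
  have hsurj : Function.Surjective Θ := hcont.surjective
    (hper'.tendsto_atTop_intervalIntegral_of_pos' (hi _ _) hp Real.pi_pos)
    (hper'.tendsto_atBot_intervalIntegral_of_pos' (hi _ _) hp Real.pi_pos)
  set e := hmono.orderIsoOfSurjective Θ hsurj
  have he : ∀ x, Θ (e.symm x) = x := fun x => e.apply_symm_apply x
  have hodd : ∀ x, Θ (-x) = -Θ x := by
    intro x
    have h := intervalIntegral.integral_comp_neg (a := 0) (b := x) (fun t => (V t)⁻¹)
    simp only [heven, neg_zero] at h
    rw [hΘ]; simp only
    rw [h, intervalIntegral.integral_symm]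
  have hadd : ∀ x, Θ (x + Real.pi) = Θ x + T := fun x =>
    hper'.intervalIntegral_add_eq_add 0 x hi |>.trans (by simp [hΘ, T])
  refine ⟨e.symm, e.symm.bijective, fun x => ?_, fun x => ?_, fun x => ?_⟩
  · have h := HasDerivAt.of_local_left_inverse (f := Θ) (g := e.symm) (a := x)
      e.symm.continuous.continuousAt (hd _) (hp _).ne' (Eventually.of_forall he)
    simpa using h
  · apply hmono.injective; rw [he, hodd, he]
  · apply hmono.injective; rw [he, hadd, he]

/-- The half period can be tuned by the amplitude of the nonlinearity. -/
theorem exists_halfPeriod_eq {k b : ℝ} (hk : 0 < k) (hb : 0 < b) {m : ℕ} (hm : k < m) :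
    ∃ K : ℝ, 0 < K ∧
      ∫ t in (0 : ℝ)..Real.pi, (√(k ^ 2 + K * sinQuotient b t))⁻¹ = Real.pi / m := by
  have hm0 : (0 : ℝ) < m := hk.trans hm
  have hW := continuous_sinQuotient hb
  obtain ⟨x₀, -, hx₀⟩ := (isCompact_Icc (a := (0 : ℝ)) (b := Real.pi)).exists_isMinOn
    (Set.nonempty_Icc.2 Real.pi_pos.le) hW.continuousOn
  set c := sinQuotient b x₀
  have hcpos : 0 < c := sinQuotient_pos hb x₀
  -- Writing `K = κ²` keeps the radicand positive for all real `κ`, so `T` is continuous on the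
  -- whole line.
  set T : ℝ → ℝ := fun κ => ∫ t in (0 : ℝ)..Real.pi, (√(k ^ 2 + κ ^ 2 * sinQuotient b t))⁻¹
  have hpos : ∀ κ t, 0 < k ^ 2 + κ ^ 2 * sinQuotient b t := fun κ t => by
    have := sinQuotient_pos hb t
    positivity
  have hT : Continuous T := by
    apply intervalIntegral.continuous_parametric_intervalIntegral_of_continuous'
    refine Continuous.inv₀ ?_ fun p => (Real.sqrt_pos.2 (hpos p.1 p.2)).ne'
    exact (continuous_const.add ((continuous_fst.pow 2).mul (hW.comp continuous_snd))).sqrt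
  have hT0 : T 0 = Real.pi / k := by
    simp [T, Real.sqrt_sq hk.le, div_eq_mul_inv]
  -- Chosen so that `κ₁² c = m²`, where `c` is the minimum of the quotient: the root is then at
  -- least `m` throughout.
  set κ₁ := m / √c
  have hκ₁ : 0 < κ₁ := by positivity
  have hT1 : T κ₁ ≤ Real.pi / m := by
    have h : T κ₁ ≤ ∫ t in (0 : ℝ)..Real.pi, (m : ℝ)⁻¹ := by
      apply intervalIntegral.integral_mono_on Real.pi_pos.le
      · apply Continuous.intervalIntegrable
        refine Continuous.inv₀ ?_ fun t => (Real.sqrt_pos.2 (hpos κ₁ t)).ne'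
        exact (continuous_const.add (continuous_const.mul hW)).sqrt
      · simp
      · intro t ht
        apply inv_anti₀ hm0
        apply Real.le_sqrt_of_sq_le
        have h1 : c ≤ sinQuotient b t := hx₀ ht
        have h2 : κ₁ ^ 2 * c = (m : ℝ) ^ 2 := by
          simp only [κ₁]; rw [div_pow, Real.sq_sqrt hcpos.le]; field_simp
        nlinarith [sq_nonneg k, mul_le_mul_of_nonneg_left h1 (sq_nonneg κ₁)]
    simpa [div_eq_mul_inv] using h
  have hlt : Real.pi / m < Real.pi / k := by
    apply div_lt_div_of_pos_left Real.pi_pos hk hm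
  obtain ⟨κ, hκ, hκT⟩ := intermediate_value_Icc' hκ₁.le hT.continuousOn
    (show Real.pi / m ∈ Set.Icc (T κ₁) (T 0) from ⟨hT1, by rw [hT0]; exact hlt.le⟩)
  refine ⟨κ ^ 2, ?_, hκT⟩
  have : κ ≠ 0 := by
    rintro rfl
    rw [hT0] at hκT
    exact hlt.ne' hκT
  positivity

/-- For `k > 0` and `b > 1/2` the equation `f'' = -k² f - K b f |f| ^ (2b - 2)` has, for some
`K > 0`, an odd `2π`-periodic solution with amplitude `1`. -/
theorem exists_periodic_profile {k b : ℝ} (hk : 0 < k) (hb : 1 / 2 < b) :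
    ∃ (K : ℝ) (f f' : ℝ → ℝ), 0 < K ∧ (∀ x, HasDerivAt f (f' x) x) ∧
      (∀ x, HasDerivAt f' (-k ^ 2 * f x - K * b * signedPow (2 * b - 1) (f x)) x) ∧
      (∀ x, f' x ^ 2 = k ^ 2 * (1 - f x ^ 2) + K * (1 - |f x| ^ (2 * b))) ∧
      (∀ x, f (-x) = -f x) ∧ Function.Periodic f (2 * Real.pi) ∧ ∃ x, f x = 1 := by
  have hb0 : 0 < b := by linarith
  -- `m` will be the number of full oscillations of `f` in one turn; exceeding `k` is what forces `K
  -- > 0`.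
  obtain ⟨m, hm⟩ := exists_nat_gt k
  have hm0 : (0 : ℝ) < m := hk.trans hm
  obtain ⟨K, hK, hKT⟩ := exists_halfPeriod_eq hk hb0 hm
  have hpos : ∀ t, 0 < k ^ 2 + K * sinQuotient b t := fun t => by
    have := sinQuotient_pos hb0 t
    positivity
  set V : ℝ → ℝ := fun t => √(k ^ 2 + K * sinQuotient b t) with hVdef
  have hV : Continuous V :=
    (continuous_const.add (continuous_const.mul (continuous_sinQuotient hb0))).sqrt
  obtain ⟨φ, hbij, hφ, hodd, hadd⟩ := exists_odd_rotation hV (fun t => Real.sqrt_pos.2 (hpos t))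
    (fun t => by simp only [hVdef, sinQuotient_neg])
    (fun t => by simp only [hVdef, sinQuotient_periodic b t])
  rw [hKT] at hadd
  have hφc : Continuous φ := continuous_iff_continuousAt.2 fun x => (hφ x).continuousAt
  -- The phase substitution turns the energy identity, degenerate at the turning points `f = ±1`,
  -- into a nondegenerate first-order equation for `φ`.
  set f : ℝ → ℝ := fun x => Real.sin (φ x)
  set f' : ℝ → ℝ := fun x => Real.cos (φ x) * V (φ x)
  have hf : ∀ x, HasDerivAt f (f' x) x := fun x => (hφ x).sin
  have hsq : ∀ x, f' x ^ 2 = k ^ 2 * (1 - f x ^ 2) + K * (1 - |f x| ^ (2 * b)) := by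
    intro x
    rw [← cos_sq_mul_sinQuotient, ← Real.cos_sq', mul_pow, Real.sq_sqrt (hpos _).le]
    ring
  have hfc : Continuous f := Real.continuous_sin.comp hφc
  have hf'c : Continuous f' := (Real.continuous_cos.comp hφc).mul (hV.comp hφc)
  refine ⟨K, f, f', hK, hf, ?_, hsq, fun x => by simp [f, hodd], ?_, ?_⟩
  -- Differentiating the energy identity gives the second-order equation only where `f' ≠ 0`. The
  -- turning points are countable and both sides are continuous, so they can be filled in.
  · have hs : (φ ⁻¹' {y | Real.cos y = 0}).Countable := by
      apply Set.Countable.preimage_of_injOn _ hbij.1.injOn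
      refine (Set.countable_range fun n : ℤ => (2 * n + 1) * Real.pi / 2).mono ?_
      intro y hy
      obtain ⟨n, hn⟩ := Real.cos_eq_zero_iff.1 hy
      exact ⟨n, hn.symm⟩
    refine hasDerivAt_of_hasDerivAt_off_countable hs hf'c ?_ ?_
    · exact (hfc.const_mul _).sub
        (((continuous_signedPow (by linarith)).comp hfc).const_mul _)
    · intro x hx
      have hne : f' x ≠ 0 := mul_ne_zero hx (Real.sqrt_pos.2 (hpos _)).ne'
      have hG : HasDerivAt (fun y => k ^ 2 * (1 - f y ^ 2) + K * (1 - |f y| ^ (2 * b)))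
          (k ^ 2 * (-(2 * f x * f' x)) +
            K * (-(2 * b * signedPow (2 * b - 1) (f x) * f' x))) x := by
        have h1 := ((hf x).pow 2).const_sub 1
        have h2 := (((hasDerivAt_abs_rpow_signedPow (a := 2 * b) (by linarith) (f x)).comp x
          (hf x))).const_sub 1
        refine ((h1.const_mul (k ^ 2)).add (h2.const_mul K)).congr_deriv ?_
        simp
      refine (hasDerivAt_of_sq_eq hf'c.continuousAt hG hsq hne).congr_deriv ?_
      field_simp
      ring
  · have hn : ∀ (n : ℕ) x, φ (x + n * (Real.pi / m)) = φ x + n * Real.pi := by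
      intro n
      induction n with
      | zero => simp
      | succ n ih =>
        intro x
        rw [show x + ((n + 1 : ℕ) : ℝ) * (Real.pi / m) =
          (x + n * (Real.pi / m)) + Real.pi / m by push_cast; ring, hadd, ih]
        push_cast; ring
    intro x
    -- `2m` half periods of length `π / m` make one turn, over which the phase gains `2mπ`.
    have h := hn (2 * m) x
    rw [show ((2 * m : ℕ) : ℝ) * (Real.pi / m) = 2 * Real.pi by push_cast; field_simp] at h
    simp only [f, h]
    rw [show ((2 * m : ℕ) : ℝ) * Real.pi = m * (2 * Real.pi) by push_cast; ring]
    exact Real.sin_add_nat_mul_two_pi _ _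
  · obtain ⟨x, hx⟩ := hbij.2 (Real.pi / 2)
    exact ⟨x, by simp [f, hx]⟩

/-! ### Polar angle in the plane. -/

/-- The identification of the Euclidean plane with `ℂ`. -/
noncomputable def planeToComplex : EuclideanSpace ℝ (Fin 2) →L[ℝ] ℂ :=
  (EuclideanSpace.proj 0 : EuclideanSpace ℝ (Fin 2) →L[ℝ] ℝ).smulRight (1 : ℂ) +
    (EuclideanSpace.proj 1 : EuclideanSpace ℝ (Fin 2) →L[ℝ] ℝ).smulRight Complex.I

theorem planeToComplex_apply (x : EuclideanSpace ℝ (Fin 2)) :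
    planeToComplex x = ⟨x 0, x 1⟩ := by
  apply Complex.ext <;> simp [planeToComplex]

theorem norm_planeToComplex (x : EuclideanSpace ℝ (Fin 2)) : ‖planeToComplex x‖ = ‖x‖ := by
  rw [planeToComplex_apply, EuclideanSpace.norm_eq, Fin.sum_univ_two, Complex.norm_def,
    Complex.normSq_mk]
  simp [sq]

theorem planeToComplex_ne_zero {x : EuclideanSpace ℝ (Fin 2)} (hx : x ≠ 0) :
    planeToComplex x ≠ 0 := by
  rw [← norm_ne_zero_iff, norm_planeToComplex]; exact norm_ne_zero_iff.2 hx

/-- The polar angle of a point of the plane. -/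
noncomputable def polarAngle (x : EuclideanSpace ℝ (Fin 2)) : ℝ := Complex.arg (planeToComplex x)

theorem norm_mul_cos_polarAngle (x : EuclideanSpace ℝ (Fin 2)) :
    ‖x‖ * Real.cos (polarAngle x) = x 0 := by
  rw [← norm_planeToComplex, polarAngle, Complex.norm_mul_cos_arg, planeToComplex_apply]

theorem norm_mul_sin_polarAngle (x : EuclideanSpace ℝ (Fin 2)) :
    ‖x‖ * Real.sin (polarAngle x) = x 1 := by
  rw [← norm_planeToComplex, polarAngle, Complex.norm_mul_sin_arg, planeToComplex_apply]

theorem polarAngle_smul {l : ℝ} (hl : 0 < l) (x : EuclideanSpace ℝ (Fin 2)) :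
    polarAngle (l • x) = polarAngle x := by
  rw [polarAngle, map_smul, Complex.real_smul, Complex.arg_real_mul _ hl, polarAngle]

theorem Function.Periodic.eq_of_angle_eq {g : ℝ → ℝ} (hg : Function.Periodic g (2 * Real.pi))
    {s t : ℝ} (h : (s : Real.Angle) = t) : g s = g t := by
  obtain ⟨n, hn⟩ := Real.Angle.angle_eq_iff_two_pi_dvd_sub.1 h
  rw [show s = t + n * (2 * Real.pi) by linarith]
  exact hg.int_mul n t

theorem Function.Periodic.apply_polarAngle_reflect {g : ℝ → ℝ}
    (hg : Function.Periodic g (2 * Real.pi)) (x : EuclideanSpace ℝ (Fin 2)) :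
    g (polarAngle !₂[x 0, -x 1]) = g (-polarAngle x) := by
  apply hg.eq_of_angle_eq
  have h : planeToComplex !₂[x 0, -x 1] = (starRingEnd ℂ) (planeToComplex x) := by
    simp only [planeToComplex_apply]
    apply Complex.ext <;> simp
  rw [polarAngle, h, Complex.arg_conj_coe_angle, polarAngle, Real.Angle.coe_neg]

theorem Function.Periodic.apply_polarAngle_cos_sin {g : ℝ → ℝ}
    (hg : Function.Periodic g (2 * Real.pi)) (t : ℝ) :
    g (polarAngle !₂[Real.cos t, Real.sin t]) = g t := by
  apply hg.eq_of_angle_eq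
  rw [polarAngle, planeToComplex_apply, ← Complex.arg_cos_add_sin_mul_I_coe_angle (t : Real.Angle)]
  congr 2
  apply Complex.ext <;> simp [-Complex.ofReal_cos, -Complex.ofReal_sin]

/-- The differential `(x₁ dx₂ - x₂ dx₁) / r²` of the polar angle. -/
noncomputable def polarForm (x : EuclideanSpace ℝ (Fin 2)) : EuclideanSpace ℝ (Fin 2) →L[ℝ] ℝ :=
  (‖x‖ ^ 2)⁻¹ • (x 0 • (EuclideanSpace.proj 1 : EuclideanSpace ℝ (Fin 2) →L[ℝ] ℝ) -
    x 1 • (EuclideanSpace.proj 0 : EuclideanSpace ℝ (Fin 2) →L[ℝ] ℝ))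

theorem hasFDerivAt_arg_comp {L : EuclideanSpace ℝ (Fin 2) →L[ℝ] ℂ} {x : EuclideanSpace ℝ (Fin 2)}
    (h : L x ∈ Complex.slitPlane) :
    HasFDerivAt (fun y => Complex.arg (L y)) (Complex.imCLM.comp ((L x)⁻¹ • L)) x := by
  have h1 : HasFDerivAt (fun y => Complex.log (L y)) ((L x)⁻¹ • L) x :=
    ((Complex.hasStrictDerivAt_log h).hasDerivAt.complexToReal_fderiv.comp x
      L.hasFDerivAt).congr_fderiv (by ext v; simp)
  simp only [← Complex.log_im]
  exact Complex.imCLM.hasFDerivAt.comp x h1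

theorem contDiffAt_arg_comp {L : EuclideanSpace ℝ (Fin 2) →L[ℝ] ℂ} {x : EuclideanSpace ℝ (Fin 2)}
    (h : L x ∈ Complex.slitPlane) {n : ℕ∞} : ContDiffAt ℝ n (fun y => Complex.arg (L y)) x := by
  have h1 : ContDiffAt ℝ n (fun y => Complex.log (L y)) x :=
    ((Complex.contDiffAt_log h).restrict_scalars ℝ).comp x L.contDiff.contDiffAt
  simp only [← Complex.log_im]
  exact Complex.imCLM.contDiff.contDiffAt.comp x h1

/-- Near every point off the origin the polar angle has a smooth representative mod `2π`. -/
theorem exists_smooth_polarAngle {x : EuclideanSpace ℝ (Fin 2)} (hx : x ≠ 0) :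
    ∃ θ : EuclideanSpace ℝ (Fin 2) → ℝ, (∀ n : ℕ∞, ContDiffAt ℝ n θ x) ∧
      HasFDerivAt θ (polarForm x) x ∧
      ∀ᶠ y in 𝓝 x, (polarAngle y : Real.Angle) = (θ y : Real.Angle) := by
  have hz := planeToComplex_ne_zero hx
  have hr : ‖x‖ ^ 2 = x 0 ^ 2 + x 1 ^ 2 := by
    rw [EuclideanSpace.norm_sq_eq, Fin.sum_univ_two]; simp
  have hform : Complex.imCLM.comp ((planeToComplex x)⁻¹ • planeToComplex) = polarForm x := by
    ext v
    simp only [ContinuousLinearMap.comp_apply, smul_apply, smul_eq_mul,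
      planeToComplex_apply, Complex.imCLM_apply, Complex.mul_im, Complex.inv_re, Complex.inv_im,
      Complex.normSq_mk, polarForm, sub_apply, PiLp.proj_apply, hr]
    ring
  by_cases h : planeToComplex x ∈ Complex.slitPlane
  · exact ⟨polarAngle, fun n => contDiffAt_arg_comp h, hform ▸ hasFDerivAt_arg_comp h,
      Eventually.of_forall fun _ => rfl⟩
  -- On the branch cut the antipodal point lies in the slit plane; its argument plus `π` is a smooth
  -- angle.
  · have h' : (-planeToComplex) x ∈ Complex.slitPlane := by
      rw [Complex.mem_slitPlane_iff, not_or, not_not, not_lt] at h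
      refine Complex.mem_slitPlane_iff.2 (Or.inl ?_)
      have hre : (planeToComplex x).re ≠ 0 := fun h0 => hz (Complex.ext h0 h.2)
      simpa using lt_of_le_of_ne h.1 hre
    refine ⟨fun y => Complex.arg ((-planeToComplex) y) + Real.pi,
      fun n => (contDiffAt_arg_comp h').add contDiffAt_const, ?_, ?_⟩
    · refine ((hasFDerivAt_arg_comp h').add_const _).congr_fderiv ?_
      rw [← hform]
      ext v
      simp
    · filter_upwards [isOpen_ne.mem_nhds hx] with y hy
      rw [Real.Angle.coe_add, neg_apply,
        Complex.arg_neg_coe_angle (planeToComplex_ne_zero hy), add_assoc,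
        Real.Angle.coe_pi_add_coe_pi, add_zero, polarAngle]

/-! ### Homogeneous functions in polar form. -/

/-- The function `r ^ a g(θ)` in polar coordinates. -/
noncomputable def polarHom (a : ℝ) (g : ℝ → ℝ) (x : EuclideanSpace ℝ (Fin 2)) : ℝ :=
  ‖x‖ ^ a * g (polarAngle x)

theorem polarHom_zero {a : ℝ} (ha : a ≠ 0) (g : ℝ → ℝ) : polarHom a g 0 = 0 := by
  simp [polarHom, Real.zero_rpow ha]

theorem isNegHomogeneousOn_polarHom (a : ℝ) (g : ℝ → ℝ) (s : Set (EuclideanSpace ℝ (Fin 2))) :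
    IsNegHomogeneousOn a (polarHom (-a) g) s := by
  intro l hl x _
  rw [polarHom, polarHom, polarAngle_smul hl, norm_smul, Real.norm_of_nonneg hl.le,
    Real.mul_rpow hl.le (norm_nonneg _), Real.rpow_neg hl.le, smul_eq_mul]
  have := (Real.rpow_pos_of_pos hl a).ne'
  field_simp

/-- Periodic profiles do not see the choice of angle, so one smooth local angle serves all of them;
the radial factor is expressed through `‖y‖ ^ 2`, which is smooth. -/
theorem exists_smooth_polarHom {x : EuclideanSpace ℝ (Fin 2)} (hx : x ≠ 0) :
    ∃ θ : EuclideanSpace ℝ (Fin 2) → ℝ, (∀ n : ℕ∞, ContDiffAt ℝ n θ x) ∧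
      HasFDerivAt θ (polarForm x) x ∧ ∀ g : ℝ → ℝ, Function.Periodic g (2 * Real.pi) →
        g (polarAngle x) = g (θ x) ∧
        ∀ a, polarHom a g =ᶠ[𝓝 x] fun y => (‖y‖ ^ 2) ^ (a / 2) * g (θ y) := by
  obtain ⟨θ, h1, h2, h3⟩ := exists_smooth_polarAngle hx
  refine ⟨θ, h1, h2, fun g hg => ⟨hg.eq_of_angle_eq h3.self_of_nhds, fun a => ?_⟩⟩
  filter_upwards [h3] with y hy
  rw [polarHom, hg.eq_of_angle_eq hy, ← Real.rpow_two, ← Real.rpow_mul (norm_nonneg _)]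
  congr 2; ring

theorem contDiffAt_polarHom {a : ℝ} {g : ℝ → ℝ} {n : ℕ∞} (hg : ContDiff ℝ n g)
    (hper : Function.Periodic g (2 * Real.pi)) {x : EuclideanSpace ℝ (Fin 2)} (hx : x ≠ 0) :
    ContDiffAt ℝ n (polarHom a g) x := by
  obtain ⟨θ, h1, -, h3⟩ := exists_smooth_polarHom hx
  refine ContDiffAt.congr_of_eventuallyEq ?_ ((h3 g hper).2 a)
  have hr : ‖x‖ ^ 2 ≠ 0 := pow_ne_zero 2 (norm_ne_zero_iff.2 hx)
  exact ((contDiff_norm_sq ℝ).contDiffAt.rpow_const_of_ne hr).mul (hg.contDiffAt.comp x (h1 n))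

theorem exists_bound_comp_polarAngle {g : ℝ → ℝ} (hg : Continuous g) :
    ∃ C, ∀ x, ‖g (polarAngle x)‖ ≤ C := by
  obtain ⟨C, hC⟩ := (isCompact_Icc (a := -Real.pi) (b := Real.pi)).exists_bound_of_continuousOn
    hg.continuousOn
  exact ⟨C, fun x => hC _ ⟨(Complex.neg_pi_lt_arg _).le, Complex.arg_le_pi _⟩⟩

theorem polarHom_isBigO {a : ℝ} {g : ℝ → ℝ} (hg : Continuous g) :
    polarHom a g =O[𝓝 0] fun x : EuclideanSpace ℝ (Fin 2) => ‖x‖ ^ a := by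
  obtain ⟨C, hC⟩ := exists_bound_comp_polarAngle hg
  refine Asymptotics.IsBigO.of_bound C (Eventually.of_forall fun x => ?_)
  rw [polarHom, norm_mul, mul_comm]
  exact mul_le_mul_of_nonneg_right (hC x) (norm_nonneg _)

theorem continuousAt_polarHom {a : ℝ} {g : ℝ → ℝ} (hg : Continuous g)
    (hper : Function.Periodic g (2 * Real.pi)) {x : EuclideanSpace ℝ (Fin 2)}
    (h : x ≠ 0 ∨ 0 < a) : ContinuousAt (polarHom a g) x := by
  rcases eq_or_ne x 0 with rfl | hx
  · have ha := h.resolve_left (by simp)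
    rw [ContinuousAt, polarHom_zero ha.ne']
    refine (polarHom_isBigO hg).trans_tendsto ?_
    have : ContinuousAt (fun x : EuclideanSpace ℝ (Fin 2) => ‖x‖ ^ a) 0 :=
      continuous_norm.continuousAt.rpow_const (Or.inr ha.le)
    simpa [ContinuousAt, Real.zero_rpow ha.ne'] using this
  · exact (contDiffAt_polarHom (n := 0) (show ContDiff ℝ 0 g from contDiff_zero.2 hg) hper hx).continuousAt

theorem continuous_polarHom {a : ℝ} (ha : 0 < a) {g : ℝ → ℝ} (hg : Continuous g)
    (hper : Function.Periodic g (2 * Real.pi)) : Continuous (polarHom a g) :=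
  continuous_iff_continuousAt.2 fun _ => continuousAt_polarHom hg hper (Or.inr ha)

/-- The angular profile of `∂₁ (r ^ a g(θ))`. -/
noncomputable def angularD₁ (a : ℝ) (g g' : ℝ → ℝ) (t : ℝ) : ℝ :=
  a * Real.cos t * g t - Real.sin t * g' t

/-- The angular profile of `∂₂ (r ^ a g(θ))`. -/
noncomputable def angularD₂ (a : ℝ) (g g' : ℝ → ℝ) (t : ℝ) : ℝ :=
  a * Real.sin t * g t + Real.cos t * g' t

theorem hasFDerivAt_polarHom {a : ℝ} {g g' : ℝ → ℝ} (hg : ∀ t, HasDerivAt g (g' t) t)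
    (hper : Function.Periodic g (2 * Real.pi)) {x : EuclideanSpace ℝ (Fin 2)}
    (h : x ≠ 0 ∨ 1 < a) :
    HasFDerivAt (polarHom a g)
      (polarHom (a - 1) (angularD₁ a g g') x •
          (EuclideanSpace.proj 0 : EuclideanSpace ℝ (Fin 2) →L[ℝ] ℝ) +
        polarHom (a - 1) (angularD₂ a g g') x •
          (EuclideanSpace.proj 1 : EuclideanSpace ℝ (Fin 2) →L[ℝ] ℝ)) x := by
  have hgc : Continuous g := continuous_iff_continuousAt.2 fun t => (hg t).continuousAt
  rcases eq_or_ne x 0 with rfl | hx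
  -- At the origin the function is bounded by a multiple of `‖x‖ ^ a` with `a > 1`, so its
  -- derivative vanishes, matching the zero value of a positive power of the norm.
  · have ha := h.resolve_left (by simp)
    rw [polarHom_zero (by linarith), polarHom_zero (by linarith), zero_smul, zero_smul, zero_add,
      hasFDerivAt_iff_isLittleO_nhds_zero]
    have h1 := hasFDerivAt_norm_rpow (0 : EuclideanSpace ℝ (Fin 2)) ha
    rw [hasFDerivAt_iff_isLittleO_nhds_zero] at h1
    simp only [zero_add, norm_zero, Real.zero_rpow (by linarith : a ≠ 0), map_zero, smul_zero,
      zero_apply, sub_zero, polarHom_zero (by linarith : a ≠ 0)] at h1 ⊢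
    exact (polarHom_isBigO hgc).trans_isLittleO h1
  · obtain ⟨θ, -, h2, h3⟩ := exists_smooth_polarHom hx
    have hr : 0 < ‖x‖ := norm_pos_iff.2 hx
    have hN := ((hasStrictFDerivAt_norm_sq x).hasFDerivAt).rpow_const (p := a / 2)
      (Or.inl (pow_ne_zero 2 hr.ne'))
    have hG := (hg (θ x)).comp_hasFDerivAt x h2
    refine ((hN.mul hG).congr_of_eventuallyEq ((h3 g hper).2 a)).congr_fderiv ?_
    have hper' : Function.Periodic g' (2 * Real.pi) := fun t => by
      have h4 := (hg (t + 2 * Real.pi)).comp_add_const t (2 * Real.pi)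
      rw [funext hper] at h4
      exact h4.unique (hg t)
    have e1 := (h3 g hper).1
    have e2 := (h3 g' hper').1
    have e3 : (‖x‖ ^ 2) ^ (a / 2 - 1) = ‖x‖ ^ a / ‖x‖ ^ 2 := by
      rw [Real.rpow_sub_one (pow_ne_zero 2 hr.ne'), ← Real.rpow_two, ← Real.rpow_mul hr.le,
        mul_div_cancel₀ a two_ne_zero]
    have e4 : (‖x‖ ^ 2) ^ (a / 2) = ‖x‖ ^ a := by
      rw [← Real.rpow_two, ← Real.rpow_mul hr.le, mul_div_cancel₀ a two_ne_zero]
    ext v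
    simp only [polarHom, angularD₁, angularD₂, polarForm, add_apply,
      smul_apply, sub_apply, smul_eq_mul, PiLp.proj_apply,
      innerSL_apply_apply, PiLp.inner_apply, Fin.sum_univ_two, e1, e2, e3, e4, nsmul_eq_mul,
      Real.rpow_sub_one hr.ne', Function.comp_apply]
    simp only [RCLike.inner_apply, conj_trivial]
    rw [← norm_mul_cos_polarAngle x, ← norm_mul_sin_polarAngle x]
    field_simp
    push_cast
    ring

/-! ### Euler profiles and the angular form of the equations. -/

/-- The angular acceleration `-(α - 1)² s - K b s |s| ^ (2b - 2)` with `b = α / (α - 1)`. -/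
noncomputable def profileAccel (α K s : ℝ) : ℝ :=
  -(α - 1) ^ 2 * s - K * (α / (α - 1)) * signedPow (2 * (α / (α - 1)) - 1) s

/-- `f` is the angular profile of the stream function `r ^ (1 - α) f(θ)` of a homogeneous Euler
flow, with derivative `f'`. -/
structure IsEulerProfile (α K : ℝ) (f f' : ℝ → ℝ) : Prop where
  hasDerivAt : ∀ t, HasDerivAt f (f' t) t
  hasDerivAt' : ∀ t, HasDerivAt f' (profileAccel α K (f t)) t
  sq_deriv : ∀ t, f' t ^ 2 =
    (α - 1) ^ 2 * (1 - f t ^ 2) + K * (1 - |f t| ^ (2 * (α / (α - 1))))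
  odd : ∀ t, f (-t) = -f t
  periodic : Function.Periodic f (2 * Real.pi)

/-- Only `(α - 1)²` enters the oscillator, so `k = |α - 1|` covers both ranges of `α`. -/
theorem exists_isEulerProfile {α : ℝ} (hα : α ≠ 1) (hb : 1 / 2 < α / (α - 1)) :
    ∃ (K : ℝ) (f f' : ℝ → ℝ), 0 < K ∧ IsEulerProfile α K f f' ∧ ∃ t, f t = 1 := by
  obtain ⟨K, f, f', hK, h1, h2, h3, h4, h5, h6⟩ :=
    exists_periodic_profile (abs_pos.2 (sub_ne_zero.2 hα)) hb
  simp only [sq_abs] at h2 h3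
  exact ⟨K, f, f', hK, ⟨h1, h2, h3, h4, h5⟩, h6⟩

namespace IsEulerProfile

variable {α K : ℝ} {f f' : ℝ → ℝ}

theorem continuous (h : IsEulerProfile α K f f') : Continuous f :=
  continuous_iff_continuousAt.2 fun t => (h.hasDerivAt t).continuousAt

theorem continuous' (h : IsEulerProfile α K f f') : Continuous f' :=
  continuous_iff_continuousAt.2 fun t => (h.hasDerivAt' t).continuousAt

theorem periodic' (h : IsEulerProfile α K f f') : Function.Periodic f' (2 * Real.pi) := fun t => by
  have h1 := (h.hasDerivAt (t + 2 * Real.pi)).comp_add_const t (2 * Real.pi)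
  rw [funext h.periodic] at h1
  exact h1.unique (h.hasDerivAt t)

theorem even' (h : IsEulerProfile α K f f') (t : ℝ) : f' (-t) = f' t := by
  have h1 := (h.hasDerivAt (-t)).comp t (hasDerivAt_neg t)
  rw [show f ∘ Neg.neg = fun t => -f t from funext h.odd] at h1
  have h2 := h1.unique (h.hasDerivAt t).neg
  linarith

/-- The radial component of the momentum equation, with pressure constant `-((α-1)² + K)/2`. -/
theorem radial_momentum (h : IsEulerProfile α K f f') (hα : α ≠ 1)
    (hb : 1 / 2 < α / (α - 1)) (t : ℝ) :
    (α - 1) * f t * profileAccel α K (f t) =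
      α * f' t ^ 2 + (α - 1) ^ 2 * f t ^ 2 - α * ((α - 1) ^ 2 + K) := by
  have hα' := sub_ne_zero.2 hα
  have h1 := mul_signedPow (a := 2 * (α / (α - 1)) - 1) (by linarith) (f t)
  rw [sub_add_cancel] at h1
  have h2 : (α - 1) * (α / (α - 1)) = α := by field_simp
  rw [h.sq_deriv, ← h1, profileAccel]
  linear_combination -K * f t * signedPow (2 * (α / (α - 1)) - 1) (f t) * h2

end IsEulerProfile

/-- The angular profile of the first velocity component. -/
noncomputable def velProfile₁ (α : ℝ) (f f' : ℝ → ℝ) : ℝ → ℝ := angularD₂ (1 - α) f f'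

/-- The angular profile of the second velocity component. -/
noncomputable def velProfile₂ (α : ℝ) (f f' : ℝ → ℝ) (t : ℝ) : ℝ := -angularD₁ (1 - α) f f' t

/-- The angular profile of the vertical velocity component. -/
noncomputable def velProfile₃ (α : ℝ) (f : ℝ → ℝ) (t : ℝ) : ℝ := signedPow (α / (α - 1)) (f t)

/-- The derivative of `velProfile₁`. -/
noncomputable def velProfileD₁ (α K : ℝ) (f f' : ℝ → ℝ) (t : ℝ) : ℝ :=
  (1 - α) * Real.cos t * f t - α * Real.sin t * f' t + Real.cos t * profileAccel α K (f t)

/-- The derivative of `velProfile₂`. -/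
noncomputable def velProfileD₂ (α K : ℝ) (f f' : ℝ → ℝ) (t : ℝ) : ℝ :=
  (1 - α) * Real.sin t * f t + α * Real.cos t * f' t + Real.sin t * profileAccel α K (f t)

/-- The velocity field with stream function `r ^ (1 - α) f(θ)` and vertical component
`r ^ (-α) sgn(f) |f| ^ (α / (α - 1))`. -/
noncomputable def eulerField (α : ℝ) (f f' : ℝ → ℝ) (x : EuclideanSpace ℝ (Fin 2)) :
    EuclideanSpace ℝ (Fin 3) :=
  !₂[polarHom (-α) (velProfile₁ α f f') x, polarHom (-α) (velProfile₂ α f f') x,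
    polarHom (-α) (velProfile₃ α f) x]

/-- The pressure `-((α - 1)² + K) / 2 r ^ (-2α)`. -/
noncomputable def eulerPressure (α K : ℝ) : EuclideanSpace ℝ (Fin 2) → ℝ :=
  polarHom (-(2 * α)) fun _ => -((α - 1) ^ 2 + K) / 2

theorem norm_rpow_mul_eulerPressure (α K : ℝ) {x : EuclideanSpace ℝ (Fin 2)} (hx : x ≠ 0) :
    ‖x‖ ^ (2 * α) * eulerPressure α K x = -((α - 1) ^ 2 + K) / 2 := by
  have h := norm_pos_iff.2 hx
  rw [eulerPressure, polarHom, ← mul_assoc, ← Real.rpow_add h]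
  simp

namespace IsEulerProfile

variable {α K : ℝ} {f f' : ℝ → ℝ}

theorem hasDerivAt_velProfile₁ (h : IsEulerProfile α K f f') (t : ℝ) :
    HasDerivAt (velProfile₁ α f f') (velProfileD₁ α K f f' t) t := by
  refine ((((Real.hasDerivAt_sin t).const_mul (1 - α)).mul (h.hasDerivAt t)).add
    ((Real.hasDerivAt_cos t).mul (h.hasDerivAt' t))).congr_deriv ?_
  rw [velProfileD₁]; ring

theorem hasDerivAt_velProfile₂ (h : IsEulerProfile α K f f') (t : ℝ) :
    HasDerivAt (velProfile₂ α f f') (velProfileD₂ α K f f' t) t := by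
  refine ((((Real.hasDerivAt_cos t).const_mul (1 - α)).mul (h.hasDerivAt t)).sub
    ((Real.hasDerivAt_sin t).mul (h.hasDerivAt' t))).neg.congr_deriv ?_
  rw [velProfileD₂]; ring

theorem hasDerivAt_velProfile₃ (h : IsEulerProfile α K f f') (hb : 1 < α / (α - 1)) (t : ℝ) :
    HasDerivAt (velProfile₃ α f)
      (α / (α - 1) * |f t| ^ (α / (α - 1) - 1) * f' t) t :=
  (hasDerivAt_signedPow hb (f t)).comp t (h.hasDerivAt t)

theorem periodic_velProfile₁ (h : IsEulerProfile α K f f') :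
    Function.Periodic (velProfile₁ α f f') (2 * Real.pi) := fun t => by
  simp [velProfile₁, angularD₂, h.periodic t, h.periodic' t]

theorem periodic_velProfile₂ (h : IsEulerProfile α K f f') :
    Function.Periodic (velProfile₂ α f f') (2 * Real.pi) := fun t => by
  simp [velProfile₂, angularD₁, h.periodic t, h.periodic' t]

theorem periodic_velProfile₃ (h : IsEulerProfile α K f f') :
    Function.Periodic (velProfile₃ α f) (2 * Real.pi) := fun t => by
  simp [velProfile₃, h.periodic t]

theorem velProfile₁_neg (h : IsEulerProfile α K f f') (t : ℝ) :
    velProfile₁ α f f' (-t) = velProfile₁ α f f' t := by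
  simp [velProfile₁, angularD₂, h.odd, h.even']

theorem velProfile₂_neg (h : IsEulerProfile α K f f') (t : ℝ) :
    velProfile₂ α f f' (-t) = -velProfile₂ α f f' t := by
  simp [velProfile₂, angularD₁, h.odd, h.even']
  ring

theorem velProfile₃_neg (h : IsEulerProfile α K f f') (t : ℝ) :
    velProfile₃ α f (-t) = -velProfile₃ α f t := by
  rw [velProfile₃, h.odd, signedPow_neg, velProfile₃]

/-- With constant `r ^ (2α) p` the tangential momentum balance is automatic, so each Cartesian
component is a cosine or sine multiple of `radial_momentum`, up to `sin² + cos² = 1`. -/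
theorem angular_momentum₁ (h : IsEulerProfile α K f f') (hα : α ≠ 1)
    (hb : 1 / 2 < α / (α - 1)) (t : ℝ) :
    velProfile₁ α f f' t * angularD₁ (-α) (velProfile₁ α f f') (velProfileD₁ α K f f') t +
      velProfile₂ α f f' t * angularD₂ (-α) (velProfile₁ α f f') (velProfileD₁ α K f f') t +
      -(2 * α) * Real.cos t * (-((α - 1) ^ 2 + K) / 2) = 0 := by
  have hQ := h.radial_momentum hα hb t
  have hs := Real.sin_sq_add_cos_sq t
  simp only [velProfile₁, velProfile₂, velProfileD₁, angularD₁, angularD₂]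
  linear_combination Real.cos t * hQ + Real.cos t * ((α - 1) * f t * profileAccel α K (f t) -
    α * f' t ^ 2 - (α - 1) ^ 2 * f t ^ 2) * hs

theorem angular_momentum₂ (h : IsEulerProfile α K f f') (hα : α ≠ 1)
    (hb : 1 / 2 < α / (α - 1)) (t : ℝ) :
    velProfile₁ α f f' t * angularD₁ (-α) (velProfile₂ α f f') (velProfileD₂ α K f f') t +
      velProfile₂ α f f' t * angularD₂ (-α) (velProfile₂ α f f') (velProfileD₂ α K f f') t +
      -(2 * α) * Real.sin t * (-((α - 1) ^ 2 + K) / 2) = 0 := by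
  have hQ := h.radial_momentum hα hb t
  have hs := Real.sin_sq_add_cos_sq t
  simp only [velProfile₁, velProfile₂, velProfileD₂, angularD₁, angularD₂]
  linear_combination Real.sin t * hQ + Real.sin t * ((α - 1) * f t * profileAccel α K (f t) -
    α * f' t ^ 2 - (α - 1) ^ 2 * f t ^ 2) * hs

end IsEulerProfile

/-- `u³` is a function of `ψ`, hence transported: the only input is `(α - 1) b = α`, and no equation
for `f` enters. -/
theorem angular_momentum₃ {α : ℝ} (f f' : ℝ → ℝ) (hα : α ≠ 1) (t : ℝ) :
    velProfile₁ α f f' t * angularD₁ (-α) (velProfile₃ α f)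
        (fun t => α / (α - 1) * |f t| ^ (α / (α - 1) - 1) * f' t) t +
      velProfile₂ α f f' t * angularD₂ (-α) (velProfile₃ α f)
        (fun t => α / (α - 1) * |f t| ^ (α / (α - 1) - 1) * f' t) t = 0 := by
  have hα' := sub_ne_zero.2 hα
  have h2 : (α - 1) * (α / (α - 1)) = α := by field_simp
  simp only [velProfile₁, velProfile₂, velProfile₃, angularD₁, angularD₂, signedPow]
  generalize α / (α - 1) = b at *
  generalize |f t| ^ (b - 1) = p
  linear_combination (Real.sin t ^ 2 + Real.cos t ^ 2) * f t * p * f' t * h2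

theorem angular_divergence (α K : ℝ) (f f' : ℝ → ℝ) (t : ℝ) :
    angularD₁ (-α) (velProfile₁ α f f') (velProfileD₁ α K f f') t +
      angularD₂ (-α) (velProfile₂ α f f') (velProfileD₂ α K f f') t = 0 := by
  simp only [velProfile₁, velProfile₂, velProfileD₁, velProfileD₂, angularD₁, angularD₂]
  ring

theorem angular_vorticity (α K : ℝ) (f f' : ℝ → ℝ) (t : ℝ) :
    angularD₁ (-α) (velProfile₂ α f f') (velProfileD₂ α K f f') t -
      angularD₂ (-α) (velProfile₁ α f f') (velProfileD₁ α K f f') t =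
      K * (α / (α - 1)) * signedPow (2 * (α / (α - 1)) - 1) (f t) := by
  have hs := Real.sin_sq_add_cos_sq t
  simp only [velProfile₁, velProfile₂, velProfileD₁, velProfileD₂, angularD₁, angularD₂,
    profileAccel]
  linear_combination (K * (α / (α - 1)) * signedPow (2 * (α / (α - 1)) - 1) (f t)) * hs

/-! ### Partial derivatives and the planar equations. -/

/-- The partial derivatives of a homogeneous function. -/
theorem partialD_polarHom {a : ℝ} {g g' : ℝ → ℝ} (hg : ∀ t, HasDerivAt g (g' t) t)
    (hper : Function.Periodic g (2 * Real.pi)) {x : EuclideanSpace ℝ (Fin 2)}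
    (h : x ≠ 0 ∨ 1 < a) :
    partialD 0 (polarHom a g) x = polarHom (a - 1) (angularD₁ a g g') x ∧
      partialD 1 (polarHom a g) x = polarHom (a - 1) (angularD₂ a g g') x := by
  simp [partialD, (hasFDerivAt_polarHom hg hper h).fderiv]

/-- The projection `horiz` as a continuous linear map. -/
noncomputable def horizCLM : EuclideanSpace ℝ (Fin 3) →L[ℝ] EuclideanSpace ℝ (Fin 2) :=
  (EuclideanSpace.proj 0 : EuclideanSpace ℝ (Fin 3) →L[ℝ] ℝ).smulRight
      (EuclideanSpace.single 0 1) +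
    (EuclideanSpace.proj 1 : EuclideanSpace ℝ (Fin 3) →L[ℝ] ℝ).smulRight
      (EuclideanSpace.single 1 1)

theorem horizCLM_apply (x : EuclideanSpace ℝ (Fin 3)) : horizCLM x = horiz x := by
  ext i; fin_cases i <;> simp [horizCLM, horiz]

theorem contDiff_horiz {n : WithTop ℕ∞} : ContDiff ℝ n horiz :=
  (funext horizCLM_apply : ⇑horizCLM = horiz) ▸ horizCLM.contDiff

theorem hasFDerivAt_extend3 {F : EuclideanSpace ℝ (Fin 2) → ℝ}
    {F' : EuclideanSpace ℝ (Fin 2) →L[ℝ] ℝ} {x : EuclideanSpace ℝ (Fin 3)}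
    (h : HasFDerivAt F F' (horiz x)) : HasFDerivAt (extend3 F) (F'.comp horizCLM) x := by
  have h1 := horizCLM.hasFDerivAt (x := x)
  rw [funext horizCLM_apply] at h1
  exact h.comp x h1

theorem partialD_extend3 {F : EuclideanSpace ℝ (Fin 2) → ℝ} {x : EuclideanSpace ℝ (Fin 3)}
    (h : DifferentiableAt ℝ F (horiz x)) :
    partialD 0 (extend3 F) x = partialD 0 F (horiz x) ∧
      partialD 1 (extend3 F) x = partialD 1 F (horiz x) ∧ partialD 2 (extend3 F) x = 0 := by
  simp only [partialD, (hasFDerivAt_extend3 h.hasFDerivAt).fderiv]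
  simp [horizCLM]

/-- The planar equations satisfied by a `2½`-dimensional solution. -/
theorem isClassicalEuler_extend3 {u : EuclideanSpace ℝ (Fin 2) → EuclideanSpace ℝ (Fin 3)}
    {p : EuclideanSpace ℝ (Fin 2) → ℝ} {s : Set (EuclideanSpace ℝ (Fin 2))} (hs : IsOpen s)
    (hu : ContDiffOn ℝ 1 u s) (hp : ContDiffOn ℝ 1 p s)
    (h0 : ∀ x ∈ s, u x 0 * partialD 0 (fun y => u y 0) x + u x 1 * partialD 1 (fun y => u y 0) x +
      partialD 0 p x = 0)
    (h1 : ∀ x ∈ s, u x 0 * partialD 0 (fun y => u y 1) x + u x 1 * partialD 1 (fun y => u y 1) x +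
      partialD 1 p x = 0)
    (h2 : ∀ x ∈ s, u x 0 * partialD 0 (fun y => u y 2) x + u x 1 * partialD 1 (fun y => u y 2) x
      = 0)
    (hdiv : ∀ x ∈ s, partialD 0 (fun y => u y 0) x + partialD 1 (fun y => u y 1) x = 0) :
    IsClassicalEuler (horiz ⁻¹' s) (extend3 u) (extend3 p) := by
  have hd : ∀ x ∈ s, ∀ i, DifferentiableAt ℝ (fun y => u y i) x := fun x hx i =>
    (((contDiffOn_euclidean.1 hu i).contDiffAt (hs.mem_nhds hx)).differentiableAt one_ne_zero)
  have hdp : ∀ x ∈ s, DifferentiableAt ℝ p x := fun x hx =>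
    (hp.contDiffAt (hs.mem_nhds hx)).differentiableAt one_ne_zero
  have key : ∀ x : EuclideanSpace ℝ (Fin 3), horiz x ∈ s → ∀ i,
      partialD 0 (fun y => extend3 u y i) x = partialD 0 (fun y => u y i) (horiz x) ∧
      partialD 1 (fun y => extend3 u y i) x = partialD 1 (fun y => u y i) (horiz x) ∧
      partialD 2 (fun y => extend3 u y i) x = 0 := fun x hx i => partialD_extend3 (hd _ hx i)
  refine ⟨hu.comp contDiff_horiz.contDiffOn fun _ hx => hx,
    hp.comp contDiff_horiz.contDiffOn fun _ hx => hx, fun x hx i => ?_, fun x hx => ?_⟩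
  · obtain ⟨k0, k1, k2⟩ := key x hx i
    obtain ⟨p0, p1, p2⟩ := partialD_extend3 (hdp _ hx)
    rw [Fin.sum_univ_three, k0, k1, k2, mul_zero, add_zero]
    fin_cases i
    · exact p0 ▸ h0 _ hx
    · exact p1 ▸ h1 _ hx
    · exact (congrArg₂ _ (h2 _ hx) p2).trans (add_zero 0)
  · rw [Fin.sum_univ_three, (key x hx 0).1, (key x hx 1).2.1, (key x hx 2).2.2, add_zero]
    exact hdiv _ hx

/-- At the origin real powers of zero add only under a sign condition; positive exponents, available
when `α < -1`, let the equations hold there too. -/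
theorem norm_rpow_add_of {a b : ℝ} {x : EuclideanSpace ℝ (Fin 2)} (h : x ≠ 0 ∨ 0 < a ∧ 0 < b) :
    ‖x‖ ^ (a + b) = ‖x‖ ^ a * ‖x‖ ^ b := by
  rcases h with h | ⟨ha, hb⟩
  · exact Real.rpow_add (norm_pos_iff.2 h) _ _
  · exact Real.rpow_add_of_nonneg (norm_nonneg _) ha.le hb.le

theorem hasDerivAt_const_zero (c t : ℝ) : HasDerivAt (fun _ : ℝ => c) ((fun _ => 0) t) t :=
  hasDerivAt_const t c

theorem periodic_const (c T : ℝ) : Function.Periodic (fun _ : ℝ => c) T := fun _ => rfl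

namespace IsEulerProfile

variable {α K : ℝ} {f f' : ℝ → ℝ}

theorem momentum₁ (h : IsEulerProfile α K f f') (hα : α ≠ 1) (hb : 1 / 2 < α / (α - 1))
    {x : EuclideanSpace ℝ (Fin 2)} (hx : x ≠ 0 ∨ α < -1) :
    eulerField α f f' x 0 * partialD 0 (fun y => eulerField α f f' y 0) x +
      eulerField α f f' x 1 * partialD 1 (fun y => eulerField α f f' y 0) x +
      partialD 0 (eulerPressure α K) x = 0 := by
  have h1 := partialD_polarHom h.hasDerivAt_velProfile₁ h.periodic_velProfile₁ (x := x)
    (a := -α) (hx.imp_right fun h => by linarith)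
  have h3 := partialD_polarHom (hasDerivAt_const_zero (-((α - 1) ^ 2 + K) / 2))
    (periodic_const _ _) (x := x) (a := -(2 * α)) (hx.imp_right fun h => by linarith)
  have hr : ‖x‖ ^ (-(2 * α) - 1) = ‖x‖ ^ (-α) * ‖x‖ ^ (-α - 1) := by
    rw [← norm_rpow_add_of (hx.imp_right fun h => ⟨by linarith, by linarith⟩)]; congr 1; ring
  change polarHom (-α) _ x * partialD 0 (polarHom (-α) _) x +
    polarHom (-α) _ x * partialD 1 (polarHom (-α) _) x + _ = 0
  rw [h1.1, h1.2, eulerPressure, h3.1]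
  have hE := h.angular_momentum₁ hα hb (polarAngle x)
  simp only [polarHom, hr]
  simp only [angularD₁] at *
  linear_combination (‖x‖ ^ (-α) * ‖x‖ ^ (-α - 1)) * hE

theorem momentum₂ (h : IsEulerProfile α K f f') (hα : α ≠ 1) (hb : 1 / 2 < α / (α - 1))
    {x : EuclideanSpace ℝ (Fin 2)} (hx : x ≠ 0 ∨ α < -1) :
    eulerField α f f' x 0 * partialD 0 (fun y => eulerField α f f' y 1) x +
      eulerField α f f' x 1 * partialD 1 (fun y => eulerField α f f' y 1) x +
      partialD 1 (eulerPressure α K) x = 0 := by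
  have h1 := partialD_polarHom h.hasDerivAt_velProfile₂ h.periodic_velProfile₂ (x := x)
    (a := -α) (hx.imp_right fun h => by linarith)
  have h3 := partialD_polarHom (hasDerivAt_const_zero (-((α - 1) ^ 2 + K) / 2))
    (periodic_const _ _) (x := x) (a := -(2 * α)) (hx.imp_right fun h => by linarith)
  have hr : ‖x‖ ^ (-(2 * α) - 1) = ‖x‖ ^ (-α) * ‖x‖ ^ (-α - 1) := by
    rw [← norm_rpow_add_of (hx.imp_right fun h => ⟨by linarith, by linarith⟩)]; congr 1; ring
  change polarHom (-α) _ x * partialD 0 (polarHom (-α) _) x +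
    polarHom (-α) _ x * partialD 1 (polarHom (-α) _) x + _ = 0
  rw [h1.1, h1.2, eulerPressure, h3.2]
  have hE := h.angular_momentum₂ hα hb (polarAngle x)
  simp only [polarHom, hr]
  simp only [angularD₂] at *
  linear_combination (‖x‖ ^ (-α) * ‖x‖ ^ (-α - 1)) * hE

theorem momentum₃ (h : IsEulerProfile α K f f') (hα : α ≠ 1) (hb : 1 < α / (α - 1))
    {x : EuclideanSpace ℝ (Fin 2)} (hx : x ≠ 0) :
    eulerField α f f' x 0 * partialD 0 (fun y => eulerField α f f' y 2) x +
      eulerField α f f' x 1 * partialD 1 (fun y => eulerField α f f' y 2) x = 0 := by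
  have h1 := partialD_polarHom (h.hasDerivAt_velProfile₃ hb) h.periodic_velProfile₃ (x := x)
    (a := -α) (Or.inl hx)
  change polarHom (-α) _ x * partialD 0 (polarHom (-α) _) x +
    polarHom (-α) _ x * partialD 1 (polarHom (-α) _) x = 0
  rw [h1.1, h1.2]
  have hE := angular_momentum₃ f f' hα (polarAngle x)
  simp only [polarHom]
  linear_combination (‖x‖ ^ (-α) * ‖x‖ ^ (-α - 1)) * hE

theorem divergence (h : IsEulerProfile α K f f') {x : EuclideanSpace ℝ (Fin 2)}
    (hx : x ≠ 0 ∨ α < -1) :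
    partialD 0 (fun y => eulerField α f f' y 0) x +
      partialD 1 (fun y => eulerField α f f' y 1) x = 0 := by
  have hx' : x ≠ 0 ∨ 1 < -α := hx.imp_right fun h => by linarith
  change partialD 0 (polarHom (-α) _) x + partialD 1 (polarHom (-α) _) x = 0
  rw [(partialD_polarHom h.hasDerivAt_velProfile₁ h.periodic_velProfile₁ hx').1,
    (partialD_polarHom h.hasDerivAt_velProfile₂ h.periodic_velProfile₂ hx').2,
    polarHom, polarHom, ← mul_add, angular_divergence, mul_zero]

theorem horizVorticity_eq (h : IsEulerProfile α K f f') {x : EuclideanSpace ℝ (Fin 2)}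
    (hx : x ≠ 0) : horizVorticity (eulerField α f f') x = ‖x‖ ^ (-α - 1) *
      (K * (α / (α - 1)) * signedPow (2 * (α / (α - 1)) - 1) (f (polarAngle x))) := by
  change partialD 0 (polarHom (-α) _) x - partialD 1 (polarHom (-α) _) x = _
  rw [(partialD_polarHom h.hasDerivAt_velProfile₂ h.periodic_velProfile₂ (Or.inl hx)).1,
    (partialD_polarHom h.hasDerivAt_velProfile₁ h.periodic_velProfile₁ (Or.inl hx)).2,
    polarHom, polarHom, ← mul_sub, angular_vorticity]

/-- On the unit circle at an angle where `f = 1`, the vorticity equals `K b` and `u³` equals 1. -/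
theorem exists_horizVorticity_ne_zero (h : IsEulerProfile α K f f') (hK : K ≠ 0)
    (hα : α / (α - 1) ≠ 0) (hf : ∃ t, f t = 1) :
    (∃ x, x ≠ 0 ∧ horizVorticity (eulerField α f f') x ≠ 0) ∧
      ∃ x, x ≠ 0 ∧ eulerField α f f' x 2 ≠ 0 := by
  obtain ⟨t, ht⟩ := hf
  set x : EuclideanSpace ℝ (Fin 2) := !₂[Real.cos t, Real.sin t]
  have hn : ‖x‖ = 1 := by simp [x, EuclideanSpace.norm_eq, Fin.sum_univ_two]
  have hx : x ≠ 0 := norm_ne_zero_iff.1 (by rw [hn]; exact one_ne_zero)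
  have hfx : f (polarAngle x) = 1 := (h.periodic.apply_polarAngle_cos_sin t).trans ht
  refine ⟨⟨x, hx, ?_⟩, x, hx, ?_⟩
  · rw [h.horizVorticity_eq hx, hfx, hn]
    simpa [signedPow, hK] using hα
  · change polarHom (-α) _ x ≠ 0
    simp [polarHom, hn, velProfile₃, hfx, signedPow]

theorem isReflectionSymmetricOn (h : IsEulerProfile α K f f')
    (s : Set (EuclideanSpace ℝ (Fin 2))) :
    IsReflectionSymmetricOn (eulerField α f f') s := by
  intro x _
  have hn : ‖(!₂[x 0, -x 1] : EuclideanSpace ℝ (Fin 2))‖ = ‖x‖ := by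
    simp [EuclideanSpace.norm_eq, Fin.sum_univ_two]
  change polarHom (-α) _ x = polarHom (-α) _ _ ∧ polarHom (-α) _ x = -polarHom (-α) _ _ ∧
    polarHom (-α) _ x = -polarHom (-α) _ _
  simp only [polarHom, hn, h.periodic_velProfile₁.apply_polarAngle_reflect,
    h.periodic_velProfile₂.apply_polarAngle_reflect,
    h.periodic_velProfile₃.apply_polarAngle_reflect, h.velProfile₁_neg, h.velProfile₂_neg,
    h.velProfile₃_neg]
  simp

end IsEulerProfile

theorem isNegHomogeneousOn_eulerField (α : ℝ) (f f' : ℝ → ℝ)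
    (s : Set (EuclideanSpace ℝ (Fin 2))) : IsNegHomogeneousOn α (eulerField α f f') s := by
  intro l hl x hx
  ext i
  fin_cases i
  all_goals exact isNegHomogeneousOn_polarHom α _ s l hl x hx

/-! ### Regularity and the classical solutions for `α > 1`. -/

theorem contDiff_succ_of_hasDerivAt {g g' : ℝ → ℝ} {n : ℕ} (hg : ∀ t, HasDerivAt g (g' t) t)
    (hg' : ContDiff ℝ n g') : ContDiff ℝ ((n + 1 : ℕ) : ℕ∞) g := by
  have h : ContDiff ℝ (n + 1) g := by
    rw [contDiff_succ_iff_deriv]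
    refine ⟨fun t => (hg t).differentiableAt, by simp, ?_⟩
    rwa [funext fun t => (hg t).deriv]
  exact_mod_cast h

namespace IsEulerProfile

variable {α K : ℝ} {f f' : ℝ → ℝ}

/-- The oscillator gains regularity: `f''` of class `Cⁿ` makes `f'` and `f`, hence the velocity
profiles, of class `Cⁿ⁺¹`. -/
theorem contDiff_velProfile (h : IsEulerProfile α K f f') {n : ℕ}
    (hn : ContDiff ℝ n fun t => signedPow (2 * (α / (α - 1)) - 1) (f t)) (hf : ContDiff ℝ n f) :
    ContDiff ℝ ((n + 1 : ℕ) : ℕ∞) (velProfile₁ α f f') ∧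
      ContDiff ℝ ((n + 1 : ℕ) : ℕ∞) (velProfile₂ α f f') := by
  have h2 : ContDiff ℝ ((n + 1 : ℕ) : ℕ∞) f' := contDiff_succ_of_hasDerivAt h.hasDerivAt'
    ((contDiff_const.mul hf).sub (contDiff_const.mul hn))
  have h1 : ContDiff ℝ ((n + 1 : ℕ) : ℕ∞) f := contDiff_succ_of_hasDerivAt h.hasDerivAt
    (h2.of_le (by exact_mod_cast Nat.le_succ n))
  exact ⟨((contDiff_const.mul Real.contDiff_sin).mul h1).add (Real.contDiff_cos.mul h2),
    (((contDiff_const.mul Real.contDiff_cos).mul h1).sub (Real.contDiff_sin.mul h2)).neg⟩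

theorem contDiffOn_horizPart (h : IsEulerProfile α K f f') {n : ℕ}
    (hn : ContDiff ℝ n fun t => signedPow (2 * (α / (α - 1)) - 1) (f t)) (hf : ContDiff ℝ n f) :
    ContDiffOn ℝ ((n + 1 : ℕ) : ℕ∞) (horizPart (eulerField α f f')) {0}ᶜ := by
  obtain ⟨h1, h2⟩ := h.contDiff_velProfile hn hf
  rw [contDiffOn_euclidean]
  intro i
  fin_cases i
  · exact fun x hx => (contDiffAt_polarHom h1 h.periodic_velProfile₁ hx).contDiffWithinAt
  · exact fun x hx => (contDiffAt_polarHom h2 h.periodic_velProfile₂ hx).contDiffWithinAt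

end IsEulerProfile

theorem exists_classical_solution {α : ℝ} (hα : 1 < α) :
    ∃ (u : EuclideanSpace ℝ (Fin 2) → EuclideanSpace ℝ (Fin 3))
      (p : EuclideanSpace ℝ (Fin 2) → ℝ),
      IsClassicalEuler {x | horiz x ≠ 0} (extend3 u) (extend3 p) ∧
      IsNegHomogeneousOn α u {0}ᶜ ∧
      IsNegHomogeneousOn (2 * α) p {0}ᶜ ∧
      (∃ c : ℝ, ∀ x, x ≠ 0 → ‖x‖ ^ (2 * α) * p x = c) ∧
      IsReflectionSymmetricOn u {0}ᶜ ∧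
      (∃ x, x ≠ 0 ∧ horizVorticity u x ≠ 0) ∧
      (∃ x, x ≠ 0 ∧ u x 2 ≠ 0) ∧
      ContDiffOn ℝ 1 u {0}ᶜ ∧
      ContDiffOn ℝ 2 (horizPart u) {0}ᶜ ∧
      ContDiffOn ℝ 1 (fun x => u x 2) {0}ᶜ := by
  -- Both exponents `b` and `2b - 1` exceed 1, so `u³` is `C¹` and `f''` is `C¹`, which makes `u^H`
  -- of class `C²`.
  have hb : 1 < α / (α - 1) := by rw [one_lt_div (by linarith)]; linarith
  have hb' : 1 / 2 < α / (α - 1) := by linarith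
  obtain ⟨K, f, f', hK, h, hf1⟩ := exists_isEulerProfile hα.ne' hb'
  obtain ⟨hvort, hu3⟩ := h.exists_horizVorticity_ne_zero hK.ne' (by linarith) hf1
  have hf : ContDiff ℝ ((1 : ℕ) : WithTop ℕ∞) f :=
    contDiff_succ_of_hasDerivAt (n := 0) h.hasDerivAt (contDiff_zero.2 h.continuous')
  have hn : ContDiff ℝ ((1 : ℕ) : WithTop ℕ∞)
      fun t => signedPow (2 * (α / (α - 1)) - 1) (f t) :=
    (contDiff_signedPow (by linarith)).comp hf
  have hH : ContDiffOn ℝ 2 (horizPart (eulerField α f f')) {0}ᶜ := h.contDiffOn_horizPart hn hf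
  have h3 : ContDiffOn ℝ 1 (fun x => eulerField α f f' x 2) {0}ᶜ := fun x hx =>
    (contDiffAt_polarHom (n := 1) ((contDiff_signedPow hb).comp hf)
      h.periodic_velProfile₃ hx).contDiffWithinAt
  have hu : ContDiffOn ℝ 1 (eulerField α f f') {0}ᶜ := by
    have hH' := contDiffOn_euclidean.1 (hH.of_le one_le_two)
    rw [contDiffOn_euclidean]
    intro i
    fin_cases i
    · exact hH' 0
    · exact hH' 1
    · exact h3
  have hp : ContDiffOn ℝ 1 (eulerPressure α K) {0}ᶜ := fun x hx =>
    (contDiffAt_polarHom (n := 1) contDiff_const (periodic_const _ _) hx).contDiffWithinAt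
  refine ⟨eulerField α f f', eulerPressure α K, ?_, isNegHomogeneousOn_eulerField _ _ _ _,
    isNegHomogeneousOn_polarHom _ _ _, ⟨_, fun x hx => norm_rpow_mul_eulerPressure α K hx⟩,
    h.isReflectionSymmetricOn _, hvort, hu3, hu, hH, h3⟩
  exact isClassicalEuler_extend3 (s := {0}ᶜ) isOpen_compl_singleton hu hp
    (fun x hx => h.momentum₁ hα.ne' hb' (Or.inl hx))
    (fun x hx => h.momentum₂ hα.ne' hb' (Or.inl hx))
    (fun x hx => h.momentum₃ hα.ne' hb hx) (fun x hx => h.divergence (Or.inl hx))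

/-! ### Weak divergence and the distributional formulation. -/

theorem integral_mul_partialD {n : ℕ} {F F' φ : EuclideanSpace ℝ (Fin n) → ℝ} {j : Fin n}
    (hF : Continuous F) (hF' : Continuous F')
    (hd : ∀ x, HasLineDerivAt ℝ F (F' x) x (EuclideanSpace.single j 1))
    (hφ : ContDiff ℝ 1 φ) (hc : HasCompactSupport φ) :
    ∫ x, F x * partialD j φ x = -∫ x, F' x * φ x := by
  have hφ' : Continuous (partialD j φ) := (hφ.continuous_fderiv one_ne_zero).clm_apply
    continuous_const
  have hc' : HasCompactSupport (partialD j φ) := hc.fderiv_apply ℝ _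
  exact integral_bilinear_hasLineDerivAt_right_eq_neg_left_of_integrable
    (B := ContinuousLinearMap.mul ℝ ℝ)
    ((hF'.mul hφ.continuous).integrable_of_hasCompactSupport hc.mul_left)
    ((hF.mul hφ').integrable_of_hasCompactSupport hc'.mul_left)
    ((hF.mul hφ.continuous).integrable_of_hasCompactSupport hc.mul_left)
    (fun x _ => hd x)
    (fun x _ => ((hφ.differentiable one_ne_zero) x).hasFDerivAt.hasLineDerivAt _)

theorem continuous_partialD {n : ℕ} {φ : EuclideanSpace ℝ (Fin n) → ℝ} (hφ : ContDiff ℝ 1 φ)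
    (j : Fin n) : Continuous (partialD j φ) :=
  (hφ.continuous_fderiv one_ne_zero).clm_apply continuous_const

theorem integrable_mul_partialD {n : ℕ} {F φ : EuclideanSpace ℝ (Fin n) → ℝ} (hF : Continuous F)
    (hφ : ContDiff ℝ 1 φ) (hc : HasCompactSupport φ) (j : Fin n) :
    Integrable fun x => F x * partialD j φ x :=
  (hF.mul (continuous_partialD hφ j)).integrable_of_hasCompactSupport
    (hc.fderiv_apply ℝ _).mul_left

theorem hasLineDerivAt_extend3 {F : EuclideanSpace ℝ (Fin 2) → ℝ} {x : EuclideanSpace ℝ (Fin 3)}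
    (h : DifferentiableAt ℝ F (horiz x)) :
    HasLineDerivAt ℝ (extend3 F) (partialD 0 F (horiz x)) x (EuclideanSpace.single 0 1) ∧
      HasLineDerivAt ℝ (extend3 F) (partialD 1 F (horiz x)) x (EuclideanSpace.single 1 1) := by
  obtain ⟨h0, h1, -⟩ := partialD_extend3 h
  have hd := (hasFDerivAt_extend3 h.hasFDerivAt).differentiableAt.hasFDerivAt
  exact ⟨h0 ▸ hd.hasLineDerivAt _, h1 ▸ hd.hasLineDerivAt _⟩

theorem hasLineDerivAt_extend3_vertical (F : EuclideanSpace ℝ (Fin 2) → ℝ)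
    (x : EuclideanSpace ℝ (Fin 3)) :
    HasLineDerivAt ℝ (extend3 F) 0 x (EuclideanSpace.single 2 1) := by
  have h : (fun t : ℝ => extend3 F (x + t • EuclideanSpace.single 2 1)) = fun _ => extend3 F x := by
    funext t
    simp only [extend3, ← horizCLM_apply]
    congr 1
    simp [horizCLM]
  rw [HasLineDerivAt, h]
  exact hasDerivAt_const _ _

theorem Continuous.extend3 {F : EuclideanSpace ℝ (Fin 2) → ℝ} (hF : Continuous F) :
    Continuous (extend3 F) :=
  hF.comp (contDiff_horiz (n := 0)).continuous

theorem integral_extend3_mul_partialD_vertical {F : EuclideanSpace ℝ (Fin 2) → ℝ}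
    (hF : Continuous F) {φ : EuclideanSpace ℝ (Fin 3) → ℝ} (hφ : ContDiff ℝ 1 φ)
    (hc : HasCompactSupport φ) : ∫ x, extend3 F x * partialD 2 φ x = 0 := by
  rw [integral_mul_partialD (F' := fun _ => 0) hF.extend3 continuous_const
    (hasLineDerivAt_extend3_vertical F) hφ hc]
  simp

/-- A planar field with vanishing divergence has, extended by an arbitrary continuous vertical
component, vanishing weak divergence. -/
theorem weak_divergence_extend3 {A B C : EuclideanSpace ℝ (Fin 2) → ℝ}
    (hA : ContDiff ℝ 1 A) (hB : ContDiff ℝ 1 B) (hC : Continuous C)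
    (h : ∀ x, partialD 0 A x + partialD 1 B x = 0)
    {φ : EuclideanSpace ℝ (Fin 3) → ℝ} (hφ : ContDiff ℝ 1 φ) (hc : HasCompactSupport φ) :
    ∫ x, (extend3 A x * partialD 0 φ x + extend3 B x * partialD 1 φ x +
      extend3 C x * partialD 2 φ x) = 0 := by
  have iA := integrable_mul_partialD hA.continuous.extend3 hφ hc 0
  have iB := integrable_mul_partialD hB.continuous.extend3 hφ hc 1
  have iC := integrable_mul_partialD hC.extend3 hφ hc 2
  have iAB : Integrable fun x => extend3 A x * partialD 0 φ x + extend3 B x * partialD 1 φ x :=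
    iA.add iB
  have cA := (continuous_partialD hA 0).extend3
  have cB := (continuous_partialD hB 1).extend3
  have jA : Integrable fun x => extend3 (partialD 0 A) x * φ x :=
    (cA.mul hφ.continuous).integrable_of_hasCompactSupport hc.mul_left
  have jB : Integrable fun x => extend3 (partialD 1 B) x * φ x :=
    (cB.mul hφ.continuous).integrable_of_hasCompactSupport hc.mul_left
  rw [integral_add iAB iC, integral_add iA iB,
    integral_extend3_mul_partialD_vertical hC hφ hc,
    integral_mul_partialD hA.continuous.extend3 cA
      (fun x => (hasLineDerivAt_extend3 (hA.differentiable one_ne_zero _)).1) hφ hc,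
    integral_mul_partialD hB.continuous.extend3 cB
      (fun x => (hasLineDerivAt_extend3 (hB.differentiable one_ne_zero _)).2) hφ hc,
    ← neg_add, add_zero, neg_eq_zero, ← integral_add jA jB]
  simp only [← add_mul]
  simp [extend3, h]

/-- The rotated gradient of a planar `C¹` function, extended by an arbitrary continuous vertical
component, has vanishing weak divergence. -/
theorem weak_divergence_perp_grad {H C : EuclideanSpace ℝ (Fin 2) → ℝ} (hH : ContDiff ℝ 1 H)
    (hC : Continuous C) {φ : EuclideanSpace ℝ (Fin 3) → ℝ} (hφ : ContDiff ℝ 2 φ)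
    (hc : HasCompactSupport φ) :
    ∫ x, (extend3 (partialD 1 H) x * partialD 0 φ x +
      extend3 (fun y => -partialD 0 H y) x * partialD 1 φ x + extend3 C x * partialD 2 φ x) = 0 := by
  have hφ1 : ContDiff ℝ 1 φ := hφ.of_le one_le_two
  have c0 := (continuous_partialD hH 0).extend3
  have c1 := (continuous_partialD hH 1).extend3
  have hpd : ∀ j, ContDiff ℝ 1 (partialD j φ) := fun j =>
    (hφ.fderiv_right (m := 1) (by norm_num)).clm_apply contDiff_const
  have hpc : ∀ j, HasCompactSupport (partialD j φ) := fun j => hc.fderiv_apply ℝ _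
  have hd := fun x => hasLineDerivAt_extend3 (x := x) (hH.differentiable one_ne_zero (horiz x))
  -- Each term is integrated by parts onto `H`, with a partial derivative of `φ` as test function.
  -- The two results cancel by symmetry of second derivatives.
  have i0 := integral_mul_partialD hH.continuous.extend3 c0 (fun x => (hd x).1) (hpd 1) (hpc 1)
  have i1 := integral_mul_partialD hH.continuous.extend3 c1 (fun x => (hd x).2) (hpd 0) (hpc 0)
  have hsymm : partialD 0 (partialD 1 φ) = partialD 1 (partialD 0 φ) := by
    funext x
    have hs : IsSymmSndFDerivAt ℝ φ x := hφ.contDiffAt.isSymmSndFDerivAt (by simp)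
    have hdx : DifferentiableAt ℝ (fderiv ℝ φ) x :=
      (hφ.fderiv_right (m := 1) (by norm_num)).differentiable one_ne_zero x
    have hj : ∀ i j : Fin 3, partialD i (partialD j φ) x =
        fderiv ℝ (fderiv ℝ φ) x (EuclideanSpace.single i 1) (EuclideanSpace.single j 1) := by
      intro i j
      rw [partialD, show partialD j φ = fun y => fderiv ℝ φ y (EuclideanSpace.single j 1) from rfl,
        fderiv_clm_apply hdx (differentiableAt_const _)]
      simp
    rw [hj, hj]
    exact hs _ _
  have hneg : ∀ x, extend3 (fun y => -partialD 0 H y) x * partialD 1 φ x =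
      -(extend3 (partialD 0 H) x * partialD 1 φ x) := fun x => by simp [extend3]
  simp only [hneg]
  have iA := integrable_mul_partialD c1 hφ1 hc 0
  have iB : Integrable fun x => -(extend3 (partialD 0 H) x * partialD 1 φ x) :=
    (integrable_mul_partialD c0 hφ1 hc 1).neg
  have iC := integrable_mul_partialD hC.extend3 hφ1 hc 2
  have iAB : Integrable fun x => extend3 (partialD 1 H) x * partialD 0 φ x +
      -(extend3 (partialD 0 H) x * partialD 1 φ x) := iA.add iB
  rw [integral_add iAB iC, integral_add iA iB, integral_neg,
    integral_extend3_mul_partialD_vertical hC hφ1 hc]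
  rw [hsymm, i1] at i0
  simp only [extend3] at i0 ⊢
  linarith

/-- For `a > 1` the gradient has positive degree `a - 1`, so it is continuous and zero at the
origin. -/
theorem contDiff_polarHom {a : ℝ} (ha : 1 < a) {g g' : ℝ → ℝ} (hg : ∀ t, HasDerivAt g (g' t) t)
    (hg' : Continuous g') (hper : Function.Periodic g (2 * Real.pi))
    (hper' : Function.Periodic g' (2 * Real.pi)) : ContDiff ℝ 1 (polarHom a g) := by
  have hgc : Continuous g := continuous_iff_continuousAt.2 fun t => (hg t).continuousAt
  rw [contDiff_one_iff_fderiv]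
  have hd := fun x => hasFDerivAt_polarHom hg hper (x := x) (Or.inr ha)
  refine ⟨fun x => (hd x).differentiableAt, ?_⟩
  rw [funext fun x => (hd x).fderiv]
  refine .add (.smul (continuous_polarHom (by linarith) ?_ ?_) continuous_const)
    (.smul (continuous_polarHom (by linarith) ?_ ?_) continuous_const)
  · exact ((Real.continuous_cos.const_mul a).mul hgc).sub (Real.continuous_sin.mul hg')
  · intro t; simp [angularD₁, hper t, hper' t]
  · exact ((Real.continuous_sin.const_mul a).mul hgc).add (Real.continuous_cos.mul hg')
  · intro t; simp [angularD₂, hper t, hper' t]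

theorem partialD_mul {n : ℕ} {F G : EuclideanSpace ℝ (Fin n) → ℝ} {x : EuclideanSpace ℝ (Fin n)}
    (hF : DifferentiableAt ℝ F x) (hG : DifferentiableAt ℝ G x) (j : Fin n) :
    partialD j (fun y => F y * G y) x = F x * partialD j G x + G x * partialD j F x := by
  rw [partialD, fderiv_fun_mul hF hG]
  simp [partialD]

theorem partialD_add {n : ℕ} {F G : EuclideanSpace ℝ (Fin n) → ℝ} {x : EuclideanSpace ℝ (Fin n)}
    (hF : DifferentiableAt ℝ F x) (hG : DifferentiableAt ℝ G x) (j : Fin n) :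
    partialD j (fun y => F y + G y) x = partialD j F x + partialD j G x := by
  rw [partialD, fderiv_fun_add hF hG]
  simp [partialD]

/-- A `2½`-dimensional field whose horizontal part is a classical planar solution and whose
vertical part is advected through a stream function is a distributional solution. -/
theorem isDistributionalEuler_extend3 {u : EuclideanSpace ℝ (Fin 2) → EuclideanSpace ℝ (Fin 3)}
    {p H : EuclideanSpace ℝ (Fin 2) → ℝ} (hu0 : ContDiff ℝ 1 fun x => u x 0)
    (hu1 : ContDiff ℝ 1 fun x => u x 1) (hu2 : Continuous fun x => u x 2)
    (hp : ContDiff ℝ 1 p) (hH : ContDiff ℝ 1 H)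
    (h0 : ∀ x, u x 0 * partialD 0 (fun y => u y 0) x + u x 1 * partialD 1 (fun y => u y 0) x +
      partialD 0 p x = 0)
    (h1 : ∀ x, u x 0 * partialD 0 (fun y => u y 1) x + u x 1 * partialD 1 (fun y => u y 1) x +
      partialD 1 p x = 0)
    (h20 : ∀ x, u x 2 * u x 0 = partialD 1 H x) (h21 : ∀ x, u x 2 * u x 1 = -partialD 0 H x)
    (hdiv : ∀ x, partialD 0 (fun y => u y 0) x + partialD 1 (fun y => u y 1) x = 0) :
    IsDistributionalEuler (extend3 u) (extend3 p) := by
  have d0 := hu0.differentiable one_ne_zero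
  have d1 := hu1.differentiable one_ne_zero
  have dp := hp.differentiable one_ne_zero
  have hu : Continuous u := by
    have h : Continuous fun x => (WithLp.equiv 2 (Fin 3 → ℝ)) (u x) := by
      refine continuous_pi fun i => ?_
      fin_cases i
      · exact hu0.continuous
      · exact hu1.continuous
      · exact hu2
    exact (PiLp.continuous_toLp 2 _).comp h
  refine ⟨hu.comp (contDiff_horiz (n := 0)).continuous, hp.continuous.extend3,
    fun φ hφ hc => ?_⟩
  have hφ2 : ContDiff ℝ 2 φ := contDiff_infty.1 hφ 2
  have hφ1 : ContDiff ℝ 1 φ := hφ2.of_le one_le_two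
  -- The divergence of a horizontal row of `u ⊗ u + p I` is the momentum equation plus a velocity
  -- component times `∇ · u`. The vertical entry is independent of `x₃` and needs only continuity.
  have w0 := weak_divergence_extend3 (A := fun x => u x 0 * u x 0 + p x)
    (B := fun x => u x 0 * u x 1) (C := fun x => u x 0 * u x 2) ((hu0.mul hu0).add hp)
    (hu0.mul hu1) (hu0.continuous.mul hu2) (fun x => by
      rw [partialD_add ((d0 x).fun_mul (d0 x)) (dp x), partialD_mul (d0 x) (d0 x),
        partialD_mul (d0 x) (d1 x)]
      linear_combination h0 x + u x 0 * hdiv x) hφ1 hc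
  have w1 := weak_divergence_extend3 (A := fun x => u x 1 * u x 0)
    (B := fun x => u x 1 * u x 1 + p x) (C := fun x => u x 1 * u x 2)
    (hu1.mul hu0) ((hu1.mul hu1).add hp) (hu1.continuous.mul hu2) (fun x => by
      rw [partialD_add ((d1 x).fun_mul (d1 x)) (dp x), partialD_mul (d1 x) (d1 x),
        partialD_mul (d1 x) (d0 x)]
      linear_combination h1 x + u x 1 * hdiv x) hφ1 hc
  -- Here `u³` need not be differentiable; the row is handled through the stream function `H` of `u³
  -- u^H`.
  have w2 := weak_divergence_perp_grad (C := fun x => u x 2 * u x 2 + p x) hH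
    ((hu2.mul hu2).add hp.continuous) hφ2 hc
  have w3 := weak_divergence_extend3 hu0 hu1 hu2 hdiv hφ1 hc
  refine ⟨fun i => ?_, ?_⟩
  · fin_cases i
    · refine (integral_congr_ae (Eventually.of_forall fun x => ?_)).trans w0
      simp only [Fin.sum_univ_three, extend3, Fin.zero_eta]; ring
    · refine (integral_congr_ae (Eventually.of_forall fun x => ?_)).trans w1
      simp only [Fin.sum_univ_three, extend3, Fin.mk_one]; ring
    · refine (integral_congr_ae (Eventually.of_forall fun x => ?_)).trans w2
      simp only [Fin.sum_univ_three, extend3, Fin.reduceFinMk, ← h20, ← h21]; ring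
  · refine (integral_congr_ae (Eventually.of_forall fun x => ?_)).trans w3
    simp only [Fin.sum_univ_three, extend3]

/-! ### The distributional solutions for `α < -1`. -/

/-- A stream function for the horizontal momentum density `u³ u^H`. -/
noncomputable def momentumStream (α : ℝ) (f : ℝ → ℝ) : EuclideanSpace ℝ (Fin 2) → ℝ :=
  polarHom (1 - 2 * α) fun t => (α / (α - 1) + 1)⁻¹ * |f t| ^ (α / (α - 1) + 1)

namespace IsEulerProfile

variable {α K : ℝ} {f f' : ℝ → ℝ}

theorem hasDerivAt_momentumStream_profile (h : IsEulerProfile α K f f') (hb : 0 < α / (α - 1))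
    (t : ℝ) : HasDerivAt (fun t => (α / (α - 1) + 1)⁻¹ * |f t| ^ (α / (α - 1) + 1))
      (velProfile₃ α f t * f' t) t := by
  have h1 := ((hasDerivAt_abs_rpow_signedPow (a := α / (α - 1) + 1) (by linarith) (f t)).comp t
    (h.hasDerivAt t)).const_mul (α / (α - 1) + 1)⁻¹
  refine h1.congr_deriv ?_
  rw [add_sub_cancel_right, velProfile₃]
  have : α / (α - 1) + 1 ≠ 0 := by linarith
  generalize α / (α - 1) + 1 = c at *
  field_simp

theorem periodic_momentumStream_profile (h : IsEulerProfile α K f f') :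
    Function.Periodic (fun t => (α / (α - 1) + 1)⁻¹ * |f t| ^ (α / (α - 1) + 1))
      (2 * Real.pi) := fun t => by simp [h.periodic t]

theorem partialD_momentumStream (h : IsEulerProfile α K f f') (hα : α < -1)
    (x : EuclideanSpace ℝ (Fin 2)) :
    eulerField α f f' x 2 * eulerField α f f' x 0 = partialD 1 (momentumStream α f) x ∧
      eulerField α f f' x 2 * eulerField α f f' x 1 = -partialD 0 (momentumStream α f) x := by
  have hα' : α - 1 ≠ 0 := by linarith
  have hb : 0 < α / (α - 1) := div_pos_of_neg_of_neg (by linarith) (by linarith)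
  have hpd := partialD_polarHom (h.hasDerivAt_momentumStream_profile hb)
    h.periodic_momentumStream_profile (x := x) (a := 1 - 2 * α) (Or.inr (by linarith))
  have hr : ‖x‖ ^ (1 - 2 * α - 1) = ‖x‖ ^ (-α) * ‖x‖ ^ (-α) := by
    rw [← norm_rpow_add_of (Or.inr ⟨by linarith, by linarith⟩)]; congr 1; ring
  change polarHom (-α) _ x * polarHom (-α) _ x = _ ∧ polarHom (-α) _ x * polarHom (-α) _ x = _
  rw [momentumStream, hpd.1, hpd.2]
  have hm := mul_signedPow (a := α / (α - 1)) (by linarith) (f (polarAngle x))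
  -- Since `b + 1 = (2α - 1) / (α - 1)`, the degree of `|ψ| ^ (b + 1)` is `1 - 2α`; this is the
  -- chain rule in the radial direction.
  have hc : (1 - 2 * α) * (α / (α - 1) + 1)⁻¹ = 1 - α := by
    rw [← div_eq_mul_inv, div_eq_iff (by linarith)]
    field_simp
    ring
  simp only [polarHom, hr, velProfile₁, velProfile₂, velProfile₃, angularD₁, angularD₂, ← hm]
  generalize signedPow (α / (α - 1)) (f (polarAngle x)) = q
  generalize (α / (α - 1) + 1)⁻¹ = c at *
  constructor
  · linear_combination -(‖x‖ ^ (-α) * ‖x‖ ^ (-α) * Real.sin (polarAngle x) *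
      f (polarAngle x) * q) * hc
  · linear_combination (‖x‖ ^ (-α) * ‖x‖ ^ (-α) * Real.cos (polarAngle x) *
      f (polarAngle x) * q) * hc

end IsEulerProfile

theorem exists_distributional_solution {α : ℝ} (hα : α < -1) :
    ∃ (u : EuclideanSpace ℝ (Fin 2) → EuclideanSpace ℝ (Fin 3))
      (p : EuclideanSpace ℝ (Fin 2) → ℝ),
      IsDistributionalEuler (extend3 u) (extend3 p) ∧
      IsNegHomogeneousOn α u Set.univ ∧
      IsNegHomogeneousOn (2 * α) p Set.univ ∧
      (∃ c : ℝ, ∀ x, x ≠ 0 → ‖x‖ ^ (2 * α) * p x = c) ∧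
      IsReflectionSymmetricOn u Set.univ ∧
      (∃ x, x ≠ 0 ∧ horizVorticity u x ≠ 0) ∧
      (∃ x, x ≠ 0 ∧ u x 2 ≠ 0) ∧
      Continuous u ∧
      ContDiffOn ℝ 1 (horizPart u) {0}ᶜ ∧
      Continuous (horizPart u) ∧
      Continuous (fun x => u x 2) := by
  have hα1 : α ≠ 1 := by linarith
  -- For negative `α` this inequality is equivalent to `α < -1`; it makes the exponent `2b - 1`
  -- positive, so that `f''` is continuous and `u^H` is `C¹`.
  have hb' : 1 / 2 < α / (α - 1) := by
    rw [← neg_div_neg_eq α, lt_div_iff₀ (by linarith)]; linarith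
  have hb : 0 < α / (α - 1) := by linarith
  obtain ⟨K, f, f', hK, h, hf1⟩ := exists_isEulerProfile hα1 hb'
  obtain ⟨hvort, hu3⟩ := h.exists_horizVorticity_ne_zero hK.ne' hb.ne' hf1
  have ha : Continuous fun t => profileAccel α K (f t) :=
    (h.continuous.const_mul _).sub (((continuous_signedPow (by linarith)).comp
      h.continuous).const_mul _)
  have hu0 : ContDiff ℝ 1 fun x => eulerField α f f' x 0 :=
    contDiff_polarHom (by linarith) h.hasDerivAt_velProfile₁
      ((((continuous_const.mul Real.continuous_cos).mul h.continuous).sub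
        ((continuous_const.mul Real.continuous_sin).mul h.continuous')).add
        (Real.continuous_cos.mul ha)) h.periodic_velProfile₁
      (fun t => by simp [velProfileD₁, h.periodic t, h.periodic' t])
  have hu1 : ContDiff ℝ 1 fun x => eulerField α f f' x 1 :=
    contDiff_polarHom (by linarith) h.hasDerivAt_velProfile₂
      ((((continuous_const.mul Real.continuous_sin).mul h.continuous).add
        ((continuous_const.mul Real.continuous_cos).mul h.continuous')).add
        (Real.continuous_sin.mul ha)) h.periodic_velProfile₂
      (fun t => by simp [velProfileD₂, h.periodic t, h.periodic' t])
  have hu2 : Continuous fun x => eulerField α f f' x 2 :=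
    continuous_polarHom (by linarith) ((continuous_signedPow hb).comp h.continuous)
      h.periodic_velProfile₃
  have hp : ContDiff ℝ 1 (eulerPressure α K) :=
    contDiff_polarHom (by linarith) (hasDerivAt_const_zero _) continuous_const
      (periodic_const _ _) (periodic_const _ _)
  have hH : ContDiff ℝ 1 (momentumStream α f) :=
    contDiff_polarHom (by linarith) (h.hasDerivAt_momentumStream_profile hb)
      (((continuous_signedPow hb).comp h.continuous).mul h.continuous')
      h.periodic_momentumStream_profile
      (fun t => by simp [h.periodic_velProfile₃ t, h.periodic' t])
  have hE := isDistributionalEuler_extend3 hu0 hu1 hu2 hp hH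
    (fun x => h.momentum₁ hα1 hb' (Or.inr hα)) (fun x => h.momentum₂ hα1 hb' (Or.inr hα))
    (fun x => (h.partialD_momentumStream hα x).1) (fun x => (h.partialD_momentumStream hα x).2)
    (fun x => h.divergence (Or.inr hα))
  have hHor : ContDiff ℝ 1 (horizPart (eulerField α f f')) := by
    rw [contDiff_euclidean]
    intro i
    fin_cases i
    · exact hu0
    · exact hu1
  have hu : Continuous (eulerField α f f') := by
    refine (PiLp.continuous_toLp 2 _).comp (continuous_pi fun i => ?_)
    fin_cases i
    · exact hu0.continuous
    · exact hu1.continuous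
    · exact hu2
  exact ⟨eulerField α f f', eulerPressure α K, hE, isNegHomogeneousOn_eulerField _ _ _ _,
    isNegHomogeneousOn_polarHom _ _ _, ⟨_, fun x hx => norm_rpow_mul_eulerPressure α K hx⟩,
    h.isReflectionSymmetricOn _, hvort, hu3, hu, hHor.contDiffOn, hHor.continuous, hu2⟩

theorem theoremB1 :
    (∀ α : ℝ, 1 < α →
      ∃ (u : EuclideanSpace ℝ (Fin 2) → EuclideanSpace ℝ (Fin 3))
        (p : EuclideanSpace ℝ (Fin 2) → ℝ),
        IsClassicalEuler {x | horiz x ≠ 0} (extend3 u) (extend3 p) ∧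
        IsNegHomogeneousOn α u {0}ᶜ ∧
        IsNegHomogeneousOn (2 * α) p {0}ᶜ ∧
        (∃ c : ℝ, ∀ x, x ≠ 0 → ‖x‖ ^ (2 * α) * p x = c) ∧
        IsReflectionSymmetricOn u {0}ᶜ ∧
        (∃ x, x ≠ 0 ∧ horizVorticity u x ≠ 0) ∧
        (∃ x, x ≠ 0 ∧ u x 2 ≠ 0) ∧
        ContDiffOn ℝ 1 u {0}ᶜ ∧
        ContDiffOn ℝ 2 (horizPart u) {0}ᶜ ∧
        ContDiffOn ℝ 1 (fun x => u x 2) {0}ᶜ) ∧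
    (∀ α : ℝ, α < -1 →
      ∃ (u : EuclideanSpace ℝ (Fin 2) → EuclideanSpace ℝ (Fin 3))
        (p : EuclideanSpace ℝ (Fin 2) → ℝ),
        IsDistributionalEuler (extend3 u) (extend3 p) ∧
        IsNegHomogeneousOn α u Set.univ ∧
        IsNegHomogeneousOn (2 * α) p Set.univ ∧
        (∃ c : ℝ, ∀ x, x ≠ 0 → ‖x‖ ^ (2 * α) * p x = c) ∧
        IsReflectionSymmetricOn u Set.univ ∧
        (∃ x, x ≠ 0 ∧ horizVorticity u x ≠ 0) ∧
        (∃ x, x ≠ 0 ∧ u x 2 ≠ 0) ∧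
        Continuous u ∧
        ContDiffOn ℝ 1 (horizPart u) {0}ᶜ ∧
        Continuous (horizPart u) ∧
        Continuous (fun x => u x 2)) := 
  ⟨fun _ hα => exists_classical_solution hα, fun _ hα => exists_distributional_solution hα⟩
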